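/- A \emph{linking pairing} on a finite abelian group $G$ is a symmetric bilinear form $\lambda\colon G\times G\to\mathbb{Q}/\mathbb{Z}$ whose adjoint homomorphism $G\to\mathrm{Hom}(G,\mathbb{Q}/\mathbb{Z})$ is bijective. Two linking pairings $(G,\lambda)$, $(G',\lambda')$ are isomorphic if there is a group isomorphism $\phi\colon G\to G'$ with $\lambda'(\phi(x),\phi(y))=\lambda(x,y)$ for all $x,y\in G$; their orthogonal sum is the pairing $((x,x'),(y,y'))\mapsto\lambda(x,y)+\lambda'(x',y')$ on $G\times G'$. Let $\mathfrak{M}$ be the commutative monoid of isomorphism classes of linking pairings on finite abelian $2$-groups, under orthogonal sum. Let $(G,\lambda)$ be a linking pairing on a finite abelian $2$-group. It has an orthogonal direct sum decomposition $G=\bigoplus_{k\ge1}G_k$ in which each $G_k$ is a free $\mathbb{Z}/2^k\mathbb{Z}$-module of finite rank, and the rank $\rho_k(\lambda)$ of $G_k$ does not depend on the decomposition. For $k\ge1$ put $$\Gamma_k(G,\lambda)=\sum_{x\in G}\exp\bigl(\pi i\,2^k\lambda(x,x)\bigr).$$ If $\Gamma_k(G,\lambda)\neq0$, then $\Gamma_k/|\Gamma_k|$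 is an eighth root of unity, and $\sigma_k(\lambda)\in\mathbb{Z}/8\mathbb{Z}$ is defined by $\Gamma_k/|\Gamma_k|=\exp(2\pi i\,\sigma_k(\lambda)/8)$; if $\Gamma_k(G,\lambda)=0$, put $\sigma_k(\lambda)=\infty$. Let $\overline{\mathbb{Z}}_8=\mathbb{Z}/8\mathbb{Z}\cup\{\infty\}$ be the monoid obtained from the group $\mathbb{Z}/8\mathbb{Z}$ by adjoining an absorbing element $\infty$. Let $\mathfrak{T}$ be the monoid, under pointwise addition, of all maps (\emph{tableaux}) $T\colon\{1,2,3,\dots\}\to\mathbb{N}\times\overline{\mathbb{Z}}_8$. A tableau $T$ is \emph{admissible} if there is a linking pairing $(G,\lambda)$ on a finite abelian $2$-group with $T(k)=(\rho_k(\lambda),\sigma_k(\lambda))$ for all $k\ge1$. Then the admissible tableaux form a submonoid $\mathfrak{T}^{\mathrm{adm}}$ of $\mathfrak{T}$, and the map $$(\rho,\sigma)\colon\mathfrak{M}\to\mathfrak{T}^{\mathrm{adm}},\qquad [(G,\lambda)]\mapsto\bigl(\rho_k(\lambda),\sigma_k(\lambda)\bigr)_{k\ge1},$$ is a well-defined isomorphism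 of monoids. -/

import Mathlib

universe u

/-- A linking pairing on a finite abelian 2-group: a symmetric bilinear form with values in
`ℚ/ℤ` whose adjoint homomorphism `G → Hom(G, ℚ/ℤ)` is bijective. -/
structure TwoLinking where
  G : Type u
  [grp : AddCommGroup G]
  [fin : Fintype G]
  form : G →+ G →+ AddCircle (1 : ℚ)
  symm : ∀ x y, form x y = form y x
  adjoint_bijective : Function.Bijective form
  two_group : ∃ n : ℕ, Fintype.card G = 2 ^ n

namespace TwoLinking

attribute [instance] TwoLinking.grp TwoLinking.fin

/-- Two linking pairings are isomorphic if there is a group isomorphism preserving the forms. -/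
def Iso (L M : TwoLinking.{u}) : Prop :=
  ∃ e : L.G ≃+ M.G, ∀ x y, M.form (e x) (e y) = L.form x y

theorem Iso.refl (L : TwoLinking.{u}) : Iso L L := ⟨AddEquiv.refl _, fun _ _ => rfl⟩

theorem Iso.symm {L M : TwoLinking.{u}} : Iso L M → Iso M L := by
  rintro ⟨e, he⟩
  exact ⟨e.symm, fun x y => by rw [← he]; simp⟩

theorem Iso.trans {L M N : TwoLinking.{u}} : Iso L M → Iso M N → Iso L N := by
  rintro ⟨e, he⟩ ⟨f, hf⟩
  exact ⟨e.trans f, fun x y => by simp [hf, he]⟩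

instance setoid : Setoid TwoLinking.{u} where
  r := Iso
  iseqv := ⟨Iso.refl, Iso.symm, Iso.trans⟩

/-- The orthogonal sum of two forms: `((x, x'), (y, y')) ↦ b x y + b' x' y'`. -/
def sumForm {G H A : Type*} [AddCommGroup G] [AddCommGroup H] [AddCommGroup A]
    (b : G →+ G →+ A) (b' : H →+ H →+ A) : G × H →+ G × H →+ A where
  toFun p := (b p.1).coprod (b' p.2)
  map_zero' := by ext; simp
  map_add' p q := by
    ext; simp [add_add_add_comm]

@[simp]
theorem sumForm_apply {G H A : Type*} [AddCommGroup G] [AddCommGroup H] [AddCommGroup A]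
    (b : G →+ G →+ A) (b' : H →+ H →+ A) (p q : G × H) :
    sumForm b b' p q = b p.1 q.1 + b' p.2 q.2 := rfl

theorem sumForm_bijective {G H A : Type*} [AddCommGroup G] [AddCommGroup H] [AddCommGroup A]
    {b : G →+ G →+ A} {b' : H →+ H →+ A}
    (hb : Function.Bijective b) (hb' : Function.Bijective b') :
    Function.Bijective (sumForm b b') := by
  constructor
  · rintro ⟨x, x'⟩ ⟨y, y'⟩ h
    have h1 : x = y := hb.1 (by
      ext z; simpa using DFunLike.congr_fun h (z, 0))
    have h2 : x' = y' := hb'.1 (by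
      ext z; simpa using DFunLike.congr_fun h (0, z))
    rw [h1, h2]
  · intro f
    obtain ⟨x, hx⟩ := hb.2 (f.comp (AddMonoidHom.inl G H))
    obtain ⟨y, hy⟩ := hb'.2 (f.comp (AddMonoidHom.inr G H))
    refine ⟨(x, y), ?_⟩
    ext z
    simp [hx, hy, ← map_add]

/-- The orthogonal sum of two linking pairings. -/
def sum (L M : TwoLinking.{u}) : TwoLinking.{u} where
  G := L.G × M.G
  form := sumForm L.form M.form
  symm p q := by simp [L.symm p.1, M.symm p.2]
  adjoint_bijective := sumForm_bijective L.adjoint_bijective M.adjoint_bijective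
  two_group := by
    obtain ⟨m, hm⟩ := L.two_group
    obtain ⟨n, hn⟩ := M.two_group
    exact ⟨m + n, by rw [Fintype.card_prod, hm, hn, pow_add]⟩

/-- The linking pairing on the trivial group. -/
def trivial : TwoLinking.{u} where
  G := PUnit
  form := 0
  symm _ _ := rfl
  adjoint_bijective :=
    ⟨fun _ _ _ => rfl, fun f => ⟨0, by
      ext x
      have hx : x = 0 := rfl
      rw [hx, map_zero, map_zero]⟩⟩
  two_group := ⟨0, by simp⟩

theorem sum_congr {L L' M M' : TwoLinking.{u}} :
    Iso L L' → Iso M M' → Iso (sum L M) (sum L' M') := by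
  rintro ⟨e, he⟩ ⟨f, hf⟩
  exact ⟨e.prodCongr f, fun x y => congrArg₂ (· + ·) (he x.1 y.1) (hf x.2 y.2)⟩

theorem sum_comm (L M : TwoLinking.{u}) : Iso (sum L M) (sum M L) :=
  ⟨AddEquiv.prodComm, fun _ _ => add_comm _ _⟩

theorem sum_assoc (L M N : TwoLinking.{u}) : Iso (sum (sum L M) N) (sum L (sum M N)) :=
  ⟨AddEquiv.prodAssoc, fun _ _ => (add_assoc _ _ _).symm⟩

theorem trivial_sum (L : TwoLinking.{u}) : Iso (sum trivial L) L :=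
  ⟨AddEquiv.uniqueProd (M := L.G) (N := PUnit), fun _ _ => (zero_add _).symm⟩

/-- The function `t ↦ exp(π i 2 ^ k t)` on `ℚ` is 1-periodic for `k ≥ 1`. -/
theorem exp_periodic (k : ℕ+) :
    Function.Periodic
      (fun t : ℚ => Complex.exp (Real.pi * Complex.I * 2 ^ (k : ℕ) * (t : ℂ))) 1 := by
  intro t
  obtain ⟨j, hj⟩ := Nat.exists_eq_succ_of_ne_zero k.ne_zero
  have : (Real.pi * Complex.I * 2 ^ (k : ℕ) * ((t + 1 : ℚ) : ℂ) : ℂ)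
      = Real.pi * Complex.I * 2 ^ (k : ℕ) * (t : ℂ)
        + ((2 ^ j : ℕ) : ℂ) * (2 * Real.pi * Complex.I) := by
    rw [hj, pow_succ]; push_cast; ring
  simp only [this, Complex.exp_add, Complex.exp_nat_mul_two_pi_mul_I, mul_one]

/-- The Gauss sum `Γ_k(G, λ) = ∑_{x ∈ G} exp(π i 2 ^ k λ(x, x))`, for `k ≥ 1`. -/
noncomputable def gaussSum (L : TwoLinking.{u}) (k : ℕ+) : ℂ :=
  ∑ x : L.G, (exp_periodic k).lift (L.form x x)

/-- `L.HasSignature k s` says `σ_k(L) = s`, where `s` is `∞` (written `⊤`) if `Γ_k = 0`, and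
otherwise `s ∈ ℤ/8` is such that `Γ_k / |Γ_k| = exp(2 π i s / 8)`. -/
def HasSignature (L : TwoLinking.{u}) (k : ℕ+) : WithTop (ZMod 8) → Prop
  | none => L.gaussSum k = 0
  | some a => L.gaussSum k ≠ 0 ∧
      L.gaussSum k / (‖L.gaussSum k‖ : ℂ) = Complex.exp (2 * Real.pi * Complex.I * a.val / 8)

/-- `L.HasRanks r` says that `L` is the orthogonal direct sum of subgroups `H k`, `k ≥ 1`, where
`H k` is a free `ℤ/2^k`-module of rank `r k`. -/
def HasRanks (L : TwoLinking.{u}) (r : ℕ+ → ℕ) : Prop :=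
  ∃ H : ℕ+ → AddSubgroup L.G,
    DirectSum.IsInternal H ∧
    (∀ i j, i ≠ j → ∀ x ∈ H i, ∀ y ∈ H j, L.form x y = 0) ∧
    ∀ k, Nonempty (H k ≃+ (Fin (r k) → ZMod (2 ^ (k : ℕ))))

end TwoLinking

/-- The monoid of isomorphism classes of linking pairings on finite 2-groups. -/
def LinkingMonoid : Type (u + 1) := Quotient TwoLinking.setoid.{u}

namespace LinkingMonoid

/-- The isomorphism class of a linking pairing. -/
def mk (L : TwoLinking.{u}) : LinkingMonoid.{u} := Quotient.mk _ L

/-- Addition is induced by the orthogonal sum. -/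
instance : Add LinkingMonoid.{u} :=
  ⟨Quotient.map₂ TwoLinking.sum fun _ _ h _ _ h' => TwoLinking.sum_congr h h'⟩

instance : Zero LinkingMonoid.{u} := ⟨mk TwoLinking.trivial⟩

theorem mk_add_mk (L M : TwoLinking.{u}) : mk L + mk M = mk (L.sum M) := rfl

theorem add_comm' (a b : LinkingMonoid.{u}) : a + b = b + a :=
  Quotient.inductionOn₂ a b fun L M => Quotient.sound (TwoLinking.sum_comm L M)

theorem zero_add' (a : LinkingMonoid.{u}) : 0 + a = a :=
  Quotient.inductionOn a fun L => Quotient.sound (TwoLinking.trivial_sum L)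

instance : AddCommMonoid LinkingMonoid.{u} where
  add_assoc a b c := Quotient.inductionOn₃ a b c fun L M N =>
    Quotient.sound (TwoLinking.sum_assoc L M N)
  zero_add := zero_add'
  add_zero a := (add_comm' a 0).trans (zero_add' a)
  add_comm := add_comm'
  nsmul := nsmulRec

end LinkingMonoid

/-- The monoid of tableaux `m ↦ (r m, s m)`, `m ≥ 1`, with values in `ℕ × (ℤ/8 ∪ {∞})` and
pointwise addition, where `∞ + a = a + ∞ = ∞`. -/
abbrev Tableau : Type := ℕ+ → ℕ × WithTop (ZMod 8)

/-- `L.HasInvariants T` says that `T` is the tableau `(ρ_k(L), σ_k(L))_{k ≥ 1}`. -/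
def TwoLinking.HasInvariants (L : TwoLinking.{u}) (T : Tableau) : Prop :=
  L.HasRanks (fun k => (T k).1) ∧ ∀ k, L.HasSignature k (T k).2

/-- A tableau is admissible if it is the tableau of invariants of some linking pairing on a
finite 2-group. -/
def Tableau.IsAdmissible (T : Tableau) : Prop :=
  ∃ L : TwoLinking.{u}, L.HasInvariants T

/-!
Finite Fourier inversion over `ℚ` (divisibility by cyclotomic polynomials) shows that the Gauss sums
of a linking pairing determine how often each value is taken by `x ↦ λ(x, x)`. Two pairings with
the same torsion counts and Gauss sums therefore contain a common orthogonal summand at their top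
exponent `2^(n+1)`: a cyclic one if some `2^n λ(x, x)` is nonzero, and otherwise a hyperbolic or an
anisotropic plane, according to whether the count of `x` with `2^m λ(x, x) = 0`, `n = m + 1`, is
large or small. Splitting it off divides the torsion counts and the nonvanishing Gauss sums by
known nonzero factors. The only Gauss sum that vanishes is that of a cyclic summand at its own
level; there the Gauss sum of the complement depends only on the order and the parity of the
complement, and the parities agree for a suitable choice of the split vectors. Induction on the
order shows that torsion counts and Gauss sums classify.

The tableau carries the same information. The ranks determine the group, and the signatures
determine the Gauss sums because `|Γ_k|²` is `0` or the order of the group times a torsion count.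
Conversely the ranks are recovered from the 2-torsion of the groups `2^m G`, and `Γ_k / |Γ_k|` is
an eighth root of unity.
-/

namespace TwoLinking

/-! ### The group `ℚ/ℤ` -/

/-- The additive character `t ↦ exp(2 π i t)` of `ℚ/ℤ`. -/
noncomputable def expChar : AddChar (AddCircle (1 : ℚ)) ℂ where
  toFun := (exp_periodic 1).lift
  map_zero_eq_one' := by simpa using (exp_periodic 1).lift_coe 0
  map_add_eq_mul' a b := by
    obtain ⟨s, rfl⟩ := QuotientAddGroup.mk_surjective a
    obtain ⟨t, rfl⟩ := QuotientAddGroup.mk_surjective b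
    refine ((exp_periodic 1).lift_coe (s + t)).trans (Eq.trans ?_
      (congrArg₂ (· * ·) ((exp_periodic 1).lift_coe s) ((exp_periodic 1).lift_coe t)).symm)
    simp only [Rat.cast_add, mul_add, Complex.exp_add]

theorem expChar_coe (t : ℚ) :
    expChar (t : AddCircle (1 : ℚ)) = Complex.exp (2 * Real.pi * Complex.I * (t : ℂ)) := by
  refine ((exp_periodic 1).lift_coe t).trans (congrArg Complex.exp ?_)
  rw [PNat.one_coe, pow_one]
  ring

theorem expChar_eq_one_iff {a : AddCircle (1 : ℚ)} : expChar a = 1 ↔ a = 0 := by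
  obtain ⟨t, rfl⟩ := QuotientAddGroup.mk_surjective a
  change expChar (t : AddCircle (1 : ℚ)) = 1 ↔ (t : AddCircle (1 : ℚ)) = 0
  rw [expChar_coe, Complex.exp_eq_one_iff, AddCircle.coe_eq_zero_iff]
  refine exists_congr fun n => ?_
  rw [mul_comm (n : ℂ), mul_right_inj' Complex.two_pi_I_ne_zero, zsmul_one, eq_comm]
  norm_cast

theorem norm_expChar (a : AddCircle (1 : ℚ)) : ‖expChar a‖ = 1 := by
  obtain ⟨t, rfl⟩ := QuotientAddGroup.mk_surjective a
  rw [expChar_coe]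
  convert Complex.norm_exp_ofReal_mul_I (2 * Real.pi * t) using 3
  push_cast
  ring

theorem expChar_neg (a : AddCircle (1 : ℚ)) : expChar (-a) = starRingEnd ℂ (expChar a) := by
  rw [AddChar.map_neg_eq_inv, Complex.inv_eq_conj (norm_expChar a)]

theorem exp_periodic_lift (n : ℕ) (a : AddCircle (1 : ℚ)) :
    (exp_periodic n.succPNat).lift a = expChar (2 ^ n • a) := by
  obtain ⟨t, rfl⟩ := QuotientAddGroup.mk_surjective a
  refine ((exp_periodic n.succPNat).lift_coe t).trans (Eq.trans ?_ (expChar_coe (2 ^ n • t)).symm)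
  rw [Nat.succPNat_coe, pow_succ, nsmul_eq_mul]
  push_cast
  ring_nf

/-- The homomorphism `m ↦ m / n` from `ℤ` to `ℚ/ℤ`; it is zero for `n = 0`. -/
noncomputable def frac (n : ℕ) : ℤ →+ AddCircle (1 : ℚ) where
  toFun m := ((m / n : ℚ) : AddCircle (1 : ℚ))
  map_zero' := by simp
  map_add' a b := by rw [← AddCircle.coe_add, Int.cast_add, add_div]

theorem frac_apply (n : ℕ) (m : ℤ) : frac n m = ((m / n : ℚ) : AddCircle (1 : ℚ)) := rfl

theorem zsmul_frac (n : ℕ) (c m : ℤ) : c • frac n m = frac n (c * m) := by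
  rw [← map_zsmul, smul_eq_mul]

theorem nsmul_frac_mul (c n : ℕ) [NeZero c] (m : ℤ) : c • frac (c * n) m = frac n m := by
  have hc : (c : ℚ) ≠ 0 := NeZero.ne _
  rw [frac_apply, frac_apply, ← AddCircle.coe_nsmul, nsmul_eq_mul, Nat.cast_mul,
    ← mul_div_assoc, mul_div_mul_left _ _ hc]

theorem expChar_frac_natCast (n m : ℕ) :
    expChar (frac n m) = Complex.exp (2 * Real.pi * Complex.I / n) ^ m := by
  rw [frac_apply, expChar_coe, ← Complex.exp_nat_mul]
  push_cast
  ring_nf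

section Frac

variable {n : ℕ} [NeZero n]

theorem frac_eq_zero_iff {m : ℤ} : frac n m = 0 ↔ (n : ℤ) ∣ m := by
  have hn : (n : ℚ) ≠ 0 := NeZero.ne _
  rw [frac_apply, AddCircle.coe_eq_zero_iff]
  refine exists_congr fun c => ?_
  rw [zsmul_one, eq_div_iff hn, mul_comm, eq_comm]
  norm_cast

theorem frac_eq_frac_iff {m k : ℤ} : frac n m = frac n k ↔ (n : ℤ) ∣ m - k := by
  rw [← sub_eq_zero, ← map_sub, frac_eq_zero_iff]

theorem exists_frac_eq {a : AddCircle (1 : ℚ)} (h : n • a = 0) : ∃ m, frac n m = a := by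
  obtain ⟨t, rfl⟩ := QuotientAddGroup.mk_surjective a
  obtain ⟨m, hm⟩ := AddCircle.coe_eq_zero_iff _ |>.mp
    ((AddCircle.coe_nsmul (p := (1 : ℚ)) (n := n) (x := t)).trans h)
  have hn : (n : ℚ) ≠ 0 := NeZero.ne _
  rw [zsmul_one, nsmul_eq_mul] at hm
  refine ⟨m, ?_⟩
  rw [frac_apply, hm, mul_div_cancel_left₀ _ hn]

theorem exists_natCast_frac_eq {a : AddCircle (1 : ℚ)} (h : n • a = 0) :
    ∃ m : ℕ, m < n ∧ frac n m = a := by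
  obtain ⟨m, rfl⟩ := exists_frac_eq h
  have hn : (n : ℤ) ≠ 0 := NeZero.ne _
  refine ⟨(m % n).toNat, by have := Int.emod_lt_of_pos m (b := n); lia, ?_⟩
  rw [Int.toNat_of_nonneg (Int.emod_nonneg m hn), frac_eq_frac_iff, ← dvd_neg, neg_sub]
  exact Int.dvd_self_sub_emod

/-- The embedding `m ↦ m / n` of `ℤ/n` in `ℚ/ℤ`. -/
noncomputable def zmodFrac (n : ℕ) [NeZero n] : ZMod n →+ AddCircle (1 : ℚ) :=
  ZMod.lift n ⟨frac n, frac_eq_zero_iff.mpr dvd_rfl⟩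

theorem zmodFrac_intCast (m : ℤ) : zmodFrac n m = frac n m := ZMod.lift_coe _ _ _

theorem zmodFrac_eq_zero_iff {z : ZMod n} : zmodFrac n z = 0 ↔ z = 0 := by
  obtain ⟨m, rfl⟩ := ZMod.intCast_surjective z
  rw [zmodFrac_intCast, frac_eq_zero_iff, ZMod.intCast_zmod_eq_zero_iff_dvd]

theorem exists_zmodFrac_eq {a : AddCircle (1 : ℚ)} (h : n • a = 0) : ∃ z, zmodFrac n z = a := by
  obtain ⟨m, rfl⟩ := exists_frac_eq h
  exact ⟨m, zmodFrac_intCast m⟩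

theorem zmodFrac_mul (z w : ZMod n) : zmodFrac n (z * w) = z.val • zmodFrac n w := by
  rw [← map_nsmul, nsmul_eq_mul, ZMod.natCast_zmod_val]

end Frac

theorem two_pow_nsmul_frac_succ_eq_zero_iff {n : ℕ} {m : ℤ} :
    2 ^ n • frac (2 ^ (n + 1)) m = 0 ↔ Even m := by
  rw [pow_succ, nsmul_frac_mul, frac_eq_zero_iff, even_iff_two_dvd, Nat.cast_two]

theorem frac_two_pow_succ_two_mul (n : ℕ) (m : ℤ) :
    frac (2 ^ (n + 1)) (2 * m) = frac (2 ^ n) m := by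
  rw [← nsmul_frac_mul 2 (2 ^ n), pow_succ', ← natCast_zsmul, zsmul_frac, Nat.cast_two]

theorem eq_frac_two_one {a : AddCircle (1 : ℚ)} (h : 2 • a = 0) (h0 : a ≠ 0) : a = frac 2 1 := by
  obtain ⟨m, rfl⟩ := exists_frac_eq h
  rw [Ne, frac_eq_zero_iff] at h0
  rw [frac_eq_frac_iff]
  lia

/-! ### Gauss sums of bilinear forms -/

section BilinearForm

variable {G H A R : Type*} [AddCommGroup G] [AddCommGroup H] [AddCommGroup A] [CommRing R]

theorem form_add_self {b : G →+ G →+ A} (hb : ∀ x y, b x y = b y x) (x y : G) :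
    b (x + y) (x + y) = b x x + b y y + 2 • b x y := by
  simp only [map_add, AddMonoidHom.add_apply, hb y x]
  abel

/-- The Gauss sum `∑ ψ(b(x, x))` of a bilinear form `b` with respect to a character `ψ`. -/
def diagSum [Fintype G] (ψ : AddChar A R) (b : G →+ G →+ A) : R := ∑ x, ψ (b x x)

theorem diagSum_sumForm [Fintype G] [Fintype H] (ψ : AddChar A R) (b : G →+ G →+ A)
    (c : H →+ H →+ A) : diagSum ψ (sumForm b c) = diagSum ψ b * diagSum ψ c := by
  simp only [diagSum, sumForm_apply, AddChar.map_add_eq_mul, Fintype.sum_mul_sum,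
    Fintype.sum_prod_type]

theorem diagSum_congr [Fintype G] [Fintype H] (ψ : AddChar A R) {b : G →+ G →+ A}
    {c : H →+ H →+ A} (e : G ≃ H) (h : ∀ x, c (e x) (e x) = b x x) :
    diagSum ψ b = diagSum ψ c :=
  Fintype.sum_equiv e _ _ fun x => by rw [h]

/-- The elements on which the polarisation `2b` of `x ↦ b(x, x)` is trivial modulo `ker ψ`. -/
def polarRadical (ψ : AddChar A R) (b : G →+ G →+ A) : AddSubgroup G where
  carrier := {z | ∀ y, ψ (2 • b z y) = 1}
  zero_mem' y := by simp
  add_mem' {z w} hz hw y := by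
    rw [map_add, AddMonoidHom.add_apply, nsmul_add, AddChar.map_add_eq_mul, hz, hw, one_mul]
  neg_mem' {z} hz y := by
    rw [map_neg, AddMonoidHom.neg_apply, ← map_neg, hz]

theorem mem_polarRadical {ψ : AddChar A R} {b : G →+ G →+ A} {z : G} :
    z ∈ polarRadical ψ b ↔ ∀ y, ψ (2 • b z y) = 1 := Iff.rfl

/-- On the radical of its polarisation, `z ↦ ψ(b(z, z))` is a character. -/
def diagChar (ψ : AddChar A R) {b : G →+ G →+ A} (hb : ∀ x y, b x y = b y x) :
    AddChar (polarRadical ψ b) R where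
  toFun z := ψ (b z z)
  map_zero_eq_one' := by simp
  map_add_eq_mul' z w := by
    rw [AddSubgroup.coe_add, form_add_self hb, AddChar.map_add_eq_mul, z.2, mul_one,
      AddChar.map_add_eq_mul]

theorem sum_two_nsmul_form [Fintype G] [IsDomain R] (ψ : AddChar A R) (b : G →+ G →+ A) (z : G)
    [Decidable (z ∈ polarRadical ψ b)] :
    ∑ y, ψ (2 • b z y) = if z ∈ polarRadical ψ b then (Fintype.card G : R) else 0 := by
  classical
  have hiff : ψ.compAddMonoidHom (2 • b z) = 0 ↔ z ∈ polarRadical ψ b := by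
    rw [mem_polarRadical, AddChar.eq_zero_iff]
    rfl
  refine (ψ.compAddMonoidHom (2 • b z)).sum_eq_ite.trans ?_
  simp only [hiff]

theorem diagSum_mul_diagSum_neg [Fintype G] [IsDomain R] (ψ : AddChar A R) {b : G →+ G →+ A}
    (hb : ∀ x y, b x y = b y x) [Fintype (polarRadical ψ b)] :
    diagSum ψ b * diagSum ψ (-b) = Fintype.card G * ∑ z, diagChar ψ hb z := by
  classical
  calc diagSum ψ b * diagSum ψ (-b)
      = ∑ y, ∑ x, ψ (b x x) * ψ (-b y y) := by
        rw [diagSum, diagSum, Fintype.sum_mul_sum, Finset.sum_comm]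
        rfl
    _ = ∑ y, ∑ z, ψ (b z z) * ψ (2 • b z y) := by
        refine Finset.sum_congr rfl fun y _ => ?_
        rw [← Equiv.sum_comp (Equiv.addRight y)]
        refine Finset.sum_congr rfl fun z _ => ?_
        rw [Equiv.coe_addRight, form_add_self hb, ← AddChar.map_add_eq_mul,
          ← AddChar.map_add_eq_mul]
        congr 1
        abel
    _ = ∑ z, if z ∈ polarRadical ψ b then ψ (b z z) * Fintype.card G else 0 := by
        rw [Finset.sum_comm]
        simp only [← Finset.mul_sum, sum_two_nsmul_form, mul_ite, mul_zero]
    _ = Fintype.card G * ∑ z, diagChar ψ hb z := by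
        rw [← Finset.sum_filter, ← Finset.sum_mul, mul_comm]
        congr 1
        exact Finset.sum_subtype _ (by simp) _

theorem diagSum_mul_diagSum_neg_eq_card [Fintype G] [IsDomain R] {ψ : AddChar A R}
    {b : G →+ G →+ A} (hb : ∀ x y, b x y = b y x) (h : ∀ z ∈ polarRadical ψ b, ψ (b z z) = 1) :
    diagSum ψ b * diagSum ψ (-b) = Fintype.card G * Nat.card (polarRadical ψ b) := by
  classical
  have h0 : diagChar ψ hb = 0 := AddChar.eq_zero_iff.mpr fun z => h z z.2
  rw [diagSum_mul_diagSum_neg ψ hb, AddChar.sum_eq_ite, if_pos h0, Nat.card_eq_fintype_card]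

theorem diagSum_mul_diagSum_neg_eq_zero [Fintype G] [IsDomain R] {ψ : AddChar A R}
    {b : G →+ G →+ A} (hb : ∀ x y, b x y = b y x) {z : G} (hz : z ∈ polarRadical ψ b)
    (h : ψ (b z z) ≠ 1) : diagSum ψ b * diagSum ψ (-b) = 0 := by
  classical
  have h0 : diagChar ψ hb ≠ 0 := fun h0 => h (AddChar.eq_zero_iff.mp h0 ⟨z, hz⟩)
  rw [diagSum_mul_diagSum_neg ψ hb, AddChar.sum_eq_ite, if_neg h0, mul_zero]

/-- Left multiplication by the quaternion `a + b i + c j + d k` on `G⁴ = ℍ(ℤ) ⊗ G`. -/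
def quaternionMul (a b c d : ℤ) (p : G × G × G × G) : G × G × G × G :=
  (a • p.1 - b • p.2.1 - c • p.2.2.1 - d • p.2.2.2,
    b • p.1 + a • p.2.1 - d • p.2.2.1 + c • p.2.2.2,
    c • p.1 + d • p.2.1 + a • p.2.2.1 - b • p.2.2.2,
    d • p.1 - c • p.2.1 + b • p.2.2.1 + a • p.2.2.2)

theorem quaternionMul_conj (a b c d : ℤ) (p : G × G × G × G) :
    quaternionMul a (-b) (-c) (-d) (quaternionMul a b c d p) =
      (a ^ 2 + b ^ 2 + c ^ 2 + d ^ 2) • p := by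
  ext <;> simp only [quaternionMul, Prod.smul_fst, Prod.smul_snd] <;> module

theorem sumForm_quaternionMul {f : G →+ G →+ A} (hf : ∀ x y, f x y = f y x) (a b c d : ℤ)
    (p : G × G × G × G) :
    sumForm f (sumForm f (sumForm f f)) (quaternionMul a b c d p) (quaternionMul a b c d p) =
      (a ^ 2 + b ^ 2 + c ^ 2 + d ^ 2) • sumForm f (sumForm f (sumForm f f)) p p := by
  obtain ⟨x, y, z, w⟩ := p
  simp only [sumForm_apply, quaternionMul, map_add, map_sub, map_zsmul, AddMonoidHom.add_apply,
    AddMonoidHom.sub_apply, AddMonoidHom.zsmul_apply, hf y x, hf z x, hf w x, hf z y, hf w y,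
    hf w z]
  module

/-- By Lagrange's theorem there is an integral quaternion of norm `|G| - 1`, which acts on `G⁴` as
an isometry from `b ⊕ b ⊕ b ⊕ b` to its negative. -/
theorem diagSum_pow_four [Fintype G] (ψ : AddChar A R) {b : G →+ G →+ A}
    (hb : ∀ x y, b x y = b y x) : diagSum ψ b ^ 4 = diagSum ψ (-b) ^ 4 := by
  obtain ⟨p, q, r, s, hN⟩ := Nat.sum_four_squares (Fintype.card G - 1)
  have hN : (p : ℤ) ^ 2 + q ^ 2 + r ^ 2 + s ^ 2 = Fintype.card G - 1 := by
    zify [show 1 ≤ Fintype.card G from Fintype.card_pos] at hN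
    exact hN
  have hneg (x : G) : (Fintype.card G - 1 : ℤ) • x = -x := by
    rw [sub_smul, natCast_zsmul, card_nsmul_eq_zero, one_smul, zero_sub]
  have hpow (c : G →+ G →+ A) :
      diagSum ψ c ^ 4 = diagSum ψ (sumForm c (sumForm c (sumForm c c))) := by
    simp only [diagSum_sumForm]
    ring
  have hinj : Function.Injective (quaternionMul (G := G) p q r s) := fun x y hxy => by
    have h := congrArg (quaternionMul p (-q) (-r) (-s)) hxy
    rw [quaternionMul_conj, quaternionMul_conj, hN] at h
    simpa [Prod.ext_iff, hneg] using h
  rw [hpow, hpow]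
  refine diagSum_congr ψ (Equiv.ofBijective _ (Finite.injective_iff_bijective.mp hinj)) fun x => ?_
  rw [Equiv.ofBijective_apply, sumForm_quaternionMul (by simp [hb]), hN,
    ← AddMonoidHom.zsmul_apply, ← map_zsmul,
    show (Fintype.card G - 1 : ℤ) • x = -x from by simp [Prod.ext_iff, hneg]]
  simp [add_comm]

end BilinearForm

/-! ### Gauss sums and signatures of linking pairings -/

theorem conj_diagSum_expChar {G : Type*} [AddCommGroup G] [Fintype G]
    (b : G →+ G →+ AddCircle (1 : ℚ)) :
    starRingEnd ℂ (diagSum expChar b) = diagSum expChar (-b) := by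
  rw [diagSum, diagSum, map_sum]
  exact Finset.sum_congr rfl fun x _ => (expChar_neg _).symm

theorem exists_eq_succPNat (k : ℕ+) : ∃ n : ℕ, k = n.succPNat :=
  ⟨k.natPred, (PNat.succPNat_natPred k).symm⟩

theorem gaussSum_succPNat (L : TwoLinking.{u}) (n : ℕ) :
    L.gaussSum n.succPNat = diagSum expChar (2 ^ n • L.form) :=
  Finset.sum_congr rfl fun _ _ => exp_periodic_lift n _

theorem gaussSum_congr {L M : TwoLinking.{u}} (h : Iso L M) (k : ℕ+) :
    L.gaussSum k = M.gaussSum k := by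
  obtain ⟨e, he⟩ := h
  obtain ⟨n, rfl⟩ := exists_eq_succPNat k
  rw [gaussSum_succPNat, gaussSum_succPNat]
  exact diagSum_congr _ e.toEquiv fun x => congrArg (2 ^ n • ·) (he x x)

theorem gaussSum_sum (L M : TwoLinking.{u}) (k : ℕ+) :
    (L.sum M).gaussSum k = L.gaussSum k * M.gaussSum k := by
  obtain ⟨n, rfl⟩ := exists_eq_succPNat k
  rw [gaussSum_succPNat, gaussSum_succPNat, gaussSum_succPNat, ← diagSum_sumForm]
  exact diagSum_congr _ (Equiv.refl _) fun x => (nsmul_add _ _ _).symm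

theorem nsmul_form (L : TwoLinking.{u}) (n : ℕ) (x y : L.G) :
    n • L.form x y = L.form (n • x) y := by
  rw [map_nsmul, AddMonoidHom.nsmul_apply]

theorem form_eq_zero_iff (L : TwoLinking.{u}) {x : L.G} : (∀ y, L.form x y = 0) ↔ x = 0 := by
  rw [← map_eq_zero_iff L.form L.adjoint_bijective.1, DFunLike.ext_iff]
  rfl

theorem mem_polarRadical_form (L : TwoLinking.{u}) {n : ℕ} {z : L.G} :
    z ∈ polarRadical expChar (2 ^ n • L.form) ↔ 2 ^ (n + 1) • z = 0 := by
  rw [mem_polarRadical, ← form_eq_zero_iff]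
  refine forall_congr' fun y => ?_
  rw [expChar_eq_one_iff, AddMonoidHom.nsmul_apply, AddMonoidHom.nsmul_apply, ← mul_nsmul,
    ← pow_succ, nsmul_form]

/-- The number of elements of `A` killed by `n`. -/
noncomputable def torsionCard (A : Type*) [AddCommGroup A] (n : ℕ) : ℕ :=
  Nat.card {x : A // n • x = 0}

theorem card_polarRadical_form (L : TwoLinking.{u}) (n : ℕ) :
    Nat.card (polarRadical expChar (2 ^ n • L.form)) = torsionCard L.G (2 ^ (n + 1)) :=
  Nat.card_congr (Equiv.subtypeEquivRight fun _ => L.mem_polarRadical_form)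

theorem torsionCard_pos (A : Type*) [AddCommGroup A] [Finite A] (n : ℕ) : 0 < torsionCard A n :=
  have : Nonempty {x : A // n • x = 0} := ⟨⟨0, nsmul_zero n⟩⟩
  Nat.card_pos

theorem gaussSum_mul_conj (L : TwoLinking.{u}) {n : ℕ}
    (h : ∀ z, 2 ^ (n + 1) • z = 0 → 2 ^ n • L.form z z = 0) :
    L.gaussSum n.succPNat * starRingEnd ℂ (L.gaussSum n.succPNat) =
      Fintype.card L.G * torsionCard L.G (2 ^ (n + 1)) := by
  rw [gaussSum_succPNat, conj_diagSum_expChar, ← card_polarRadical_form]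
  refine diagSum_mul_diagSum_neg_eq_card (fun x y => congrArg (2 ^ n • ·) (L.symm x y))
    fun z hz => expChar_eq_one_iff.mpr (h z (L.mem_polarRadical_form.mp hz))

theorem gaussSum_ne_zero_iff (L : TwoLinking.{u}) {n : ℕ} :
    L.gaussSum n.succPNat ≠ 0 ↔ ∀ z, 2 ^ (n + 1) • z = 0 → 2 ^ n • L.form z z = 0 := by
  refine ⟨fun h0 z hz => ?_, fun h h0 => ?_⟩
  · by_contra h
    have hzero := diagSum_mul_diagSum_neg_eq_zero (ψ := expChar) (b := 2 ^ n • L.form)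
      (fun x y => congrArg (2 ^ n • ·) (L.symm x y)) (L.mem_polarRadical_form.mpr hz)
      (expChar_eq_one_iff.not.mpr h)
    rw [← conj_diagSum_expChar, ← gaussSum_succPNat, mul_eq_zero, map_eq_zero, or_self] at hzero
    exact h0 hzero
  · have hcard := L.gaussSum_mul_conj h
    rw [h0, zero_mul] at hcard
    have hG : (Fintype.card L.G : ℂ) ≠ 0 := Nat.cast_ne_zero.mpr Fintype.card_ne_zero
    exact mul_ne_zero hG (Nat.cast_ne_zero.mpr (torsionCard_pos _ _).ne') hcard.symm

theorem norm_gaussSum_sq (L : TwoLinking.{u}) {k : ℕ+} (h : L.gaussSum k ≠ 0) :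
    ‖L.gaussSum k‖ ^ 2 = Fintype.card L.G * torsionCard L.G (2 ^ (k : ℕ)) := by
  obtain ⟨n, rfl⟩ := exists_eq_succPNat k
  have hcard := L.gaussSum_mul_conj (L.gaussSum_ne_zero_iff.mp h)
  rw [Complex.mul_conj'] at hcard
  exact_mod_cast hcard

/-- The form is even at level `n`, in the sense that all `λ(x, x)` are killed by `2 ^ n`. When
`2 ^ (n + 1)` kills the group this says that all numerators of `λ(x, x)` over `2 ^ (n + 1)` are
even. -/
def IsEvenAt (L : TwoLinking.{u}) (n : ℕ) : Prop := ∀ x, 2 ^ n • L.form x x = 0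

theorem gaussSum_eq_card {L : TwoLinking.{u}} {n : ℕ} (h : L.IsEvenAt n) :
    L.gaussSum n.succPNat = Fintype.card L.G := by
  rw [gaussSum_succPNat]
  exact (Finset.sum_congr rfl fun x _ => expChar_eq_one_iff.mpr (h x)).trans (by simp)

theorem gaussSum_trivial (k : ℕ+) : (trivial.{u}).gaussSum k = 1 := by
  obtain ⟨n, rfl⟩ := exists_eq_succPNat k
  rw [gaussSum_eq_card fun _ => nsmul_zero _]
  exact_mod_cast Fintype.card_punit

theorem gaussSum_pow_four (L : TwoLinking.{u}) (k : ℕ+) :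
    L.gaussSum k ^ 4 = starRingEnd ℂ (L.gaussSum k) ^ 4 := by
  obtain ⟨n, rfl⟩ := exists_eq_succPNat k
  rw [gaussSum_succPNat, conj_diagSum_expChar]
  exact diagSum_pow_four _ fun x y => congrArg (2 ^ n • ·) (L.symm x y)

theorem stdAddChar_eight_apply (a : ZMod 8) :
    ZMod.stdAddChar a = Complex.exp (2 * Real.pi * Complex.I * a.val / 8) := by
  have h := ZMod.stdAddChar_coe (N := 8) (a.val : ℤ)
  rw [Int.cast_natCast, ZMod.natCast_zmod_val] at h
  exact_mod_cast h

theorem exists_stdAddChar_eight_eq {z : ℂ} (hz : z ^ 8 = 1) :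
    ∃ a : ZMod 8, ZMod.stdAddChar a = z := by
  obtain ⟨i, -, rfl⟩ := (Complex.isPrimitiveRoot_exp 8 (by norm_num)).eq_pow_of_pow_eq_one hz
  refine ⟨i, ?_⟩
  have h := ZMod.stdAddChar_coe (N := 8) (i : ℤ)
  rw [Int.cast_natCast] at h
  rw [h, ← Complex.exp_nat_mul]
  push_cast
  ring_nf

theorem hasSignature_top_iff {L : TwoLinking.{u}} {k : ℕ+} :
    L.HasSignature k ⊤ ↔ L.gaussSum k = 0 := Iff.rfl

theorem hasSignature_coe_iff {L : TwoLinking.{u}} {k : ℕ+} {a : ZMod 8} :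
    L.HasSignature k (a : WithTop (ZMod 8)) ↔ L.gaussSum k ≠ 0 ∧
      L.gaussSum k / (‖L.gaussSum k‖ : ℂ) = ZMod.stdAddChar a := by
  rw [stdAddChar_eight_apply]
  rfl

theorem exists_hasSignature (L : TwoLinking.{u}) (k : ℕ+) : ∃ s, L.HasSignature k s := by
  by_cases h : L.gaussSum k = 0
  · exact ⟨⊤, h⟩
  set z := L.gaussSum k
  have hz : (‖z‖ : ℂ) ≠ 0 := by simpa using h
  have hroot : (z / (‖z‖ : ℂ)) ^ 8 = 1 := by
    rw [div_pow, div_eq_one_iff_eq (pow_ne_zero _ hz)]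
    calc z ^ 8 = z ^ 4 * z ^ 4 := by ring
      _ = z ^ 4 * starRingEnd ℂ z ^ 4 := by rw [← L.gaussSum_pow_four k]
      _ = (z * starRingEnd ℂ z) ^ 4 := by ring
      _ = (‖z‖ : ℂ) ^ 8 := by rw [Complex.mul_conj']; ring
  obtain ⟨a, ha⟩ := exists_stdAddChar_eight_eq hroot
  exact ⟨a, hasSignature_coe_iff.mpr ⟨h, ha.symm⟩⟩

theorem HasSignature.unique {L : TwoLinking.{u}} {k : ℕ+} {s t : WithTop (ZMod 8)}
    (hs : L.HasSignature k s) (ht : L.HasSignature k t) : s = t := by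
  induction s with
  | top =>
    induction t with
    | top => rfl
    | coe b => exact absurd hs ht.1
  | coe a =>
    induction t with
    | top => exact absurd ht hs.1
    | coe b =>
      have hab := (hasSignature_coe_iff.mp hs).2.symm.trans (hasSignature_coe_iff.mp ht).2
      rw [ZMod.injective_stdAddChar hab]

theorem HasSignature.congr {L M : TwoLinking.{u}} (h : Iso L M) {k : ℕ+} {s : WithTop (ZMod 8)}
    (hs : L.HasSignature k s) : M.HasSignature k s := by
  induction s with
  | top => exact (gaussSum_congr h k).symm.trans hs
  | coe a => rwa [hasSignature_coe_iff, ← gaussSum_congr h, ← hasSignature_coe_iff]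

theorem HasSignature.sum {L M : TwoLinking.{u}} {k : ℕ+} {s t : WithTop (ZMod 8)}
    (hs : L.HasSignature k s) (ht : M.HasSignature k t) : (L.sum M).HasSignature k (s + t) := by
  induction s with
  | top => rw [WithTop.top_add, hasSignature_top_iff, gaussSum_sum,
      hasSignature_top_iff.mp hs, zero_mul]
  | coe a =>
    induction t with
    | top => rw [WithTop.add_top, hasSignature_top_iff, gaussSum_sum,
        hasSignature_top_iff.mp ht, mul_zero]
    | coe b =>
      rw [hasSignature_coe_iff] at hs ht
      rw [← WithTop.coe_add, hasSignature_coe_iff, gaussSum_sum, AddChar.map_add_eq_mul, ← hs.2,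
        ← ht.2, norm_mul, Complex.ofReal_mul, mul_div_mul_comm]
      exact ⟨mul_ne_zero hs.1 ht.1, rfl⟩

theorem hasSignature_trivial (k : ℕ+) : (trivial.{u}).HasSignature k 0 :=
  (hasSignature_coe_iff (a := 0)).mpr (by simp [gaussSum_trivial])

theorem gaussSum_eq_of_hasSignature {L M : TwoLinking.{u}} {k : ℕ+} {s : WithTop (ZMod 8)}
    (hL : L.HasSignature k s) (hM : M.HasSignature k s)
    (hcard : Fintype.card L.G = Fintype.card M.G)
    (htors : torsionCard L.G (2 ^ (k : ℕ)) = torsionCard M.G (2 ^ (k : ℕ))) :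
    L.gaussSum k = M.gaussSum k := by
  induction s with
  | top => exact Eq.trans hL (Eq.symm hM)
  | coe a =>
    rw [hasSignature_coe_iff] at hL hM
    have hnorm : ‖L.gaussSum k‖ = ‖M.gaussSum k‖ := by
      rw [← sq_eq_sq₀ (norm_nonneg _) (norm_nonneg _), norm_gaussSum_sq _ hL.1,
        norm_gaussSum_sq _ hM.1, hcard, htors]
    have hdiv := hL.2.trans hM.2.symm
    rw [hnorm] at hdiv
    exact (div_left_inj' (by simpa using hM.1)).mp hdiv

/-! ### The distribution of the values `λ(x, x)` -/

open Polynomial in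
theorem cyclotomic_dvd_of_aeval_exp_eq_zero {d : ℕ} [NeZero d] {P : ℤ[X]}
    (h : aeval (Complex.exp (2 * Real.pi * Complex.I / d)) P = 0) : cyclotomic d ℤ ∣ P := by
  have hprim := Complex.isPrimitiveRoot_exp d (NeZero.ne d)
  have hpos : 0 < d := Nat.pos_of_neZero d
  rw [cyclotomic_eq_minpoly hprim hpos]
  exact minpoly.isIntegrallyClosed_dvd (hprim.isIntegral hpos) h

open Polynomial in
theorem eq_zero_of_aeval_exp_eq_zero {n : ℕ} {P : ℤ[X]} (hdeg : P.natDegree < n)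
    (h : ∀ d, d ∣ n → aeval (Complex.exp (2 * Real.pi * Complex.I / d)) P = 0) : P = 0 := by
  have hn : n ≠ 0 := Nat.ne_zero_of_lt hdeg
  have hroot : ∀ ω ∈ nthRootsFinset n (1 : ℂ), (P.map (Int.castRingHom ℂ)).eval ω = 0 := by
    intro ω hω
    rw [mem_nthRootsFinset hn.bot_lt] at hω
    have hdvd : orderOf ω ∣ n := orderOf_dvd_of_pow_eq_one hω
    have : NeZero (orderOf ω) := ⟨ne_zero_of_dvd_ne_zero hn hdvd⟩
    obtain ⟨Q, rfl⟩ := cyclotomic_dvd_of_aeval_exp_eq_zero (h _ hdvd)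
    have hω : (cyclotomic (orderOf ω) ℂ).IsRoot ω :=
      isRoot_cyclotomic_iff.mpr (IsPrimitiveRoot.orderOf ω)
    rw [Polynomial.map_mul, eval_mul, map_cyclotomic, hω.eq_zero, zero_mul]
  have hcard : (nthRootsFinset n (1 : ℂ)).card = n :=
    (Complex.isPrimitiveRoot_exp n hn).card_nthRootsFinset
  refine (Polynomial.map_eq_zero_iff (f := Int.castRingHom ℂ) Int.cast_injective).mp ?_
  exact eq_zero_of_natDegree_lt_card_of_eval_eq_zero' _ _ hroot
    (by rw [hcard]; exact natDegree_map_le.trans_lt hdeg)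

section ValueDistribution

variable {ι κ : Type*} [Fintype ι] [Fintype κ]

open Polynomial in
theorem exists_equiv_of_sum_X_pow_eq {a : ι → ℕ} {b : κ → ℕ}
    (h : (∑ i, X ^ a i : ℤ[X]) = ∑ j, X ^ b j) : ∃ e : ι ≃ κ, ∀ i, b (e i) = a i := by
  classical
  have hfiber (m : ℕ) : Fintype.card {i // a i = m} = Fintype.card {j // b j = m} := by
    have hcoeff := congrArg (coeff · m) h
    simp only [finsetSum_coeff, coeff_X_pow, Finset.sum_boole, Nat.cast_inj] at hcoeff
    simpa only [Fintype.card_subtype, eq_comm] using hcoeff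
  exact ⟨Equiv.ofFiberEquiv fun m => Fintype.equivOfCardEq (hfiber m),
    Equiv.ofFiberEquiv_map _⟩

open Polynomial in
theorem natDegree_sum_X_pow_lt {n : ℕ} [NeZero n] {a : ι → ℕ} (ha : ∀ i, a i < n) :
    (∑ i, X ^ a i : ℤ[X]).natDegree < n := by
  refine (natDegree_sum_le _ _).trans_lt ((Finset.fold_max_lt _).mpr ?_)
  exact ⟨Nat.pos_of_neZero n, fun i _ => by simpa using ha i⟩

open Polynomial in
theorem exists_equiv_of_sum_exp_pow_eq {n : ℕ} [NeZero n] {a : ι → ℕ} {b : κ → ℕ}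
    (ha : ∀ i, a i < n) (hb : ∀ j, b j < n)
    (h : ∀ d, d ∣ n → ∑ i, Complex.exp (2 * Real.pi * Complex.I / d) ^ a i =
      ∑ j, Complex.exp (2 * Real.pi * Complex.I / d) ^ b j) :
    ∃ e : ι ≃ κ, ∀ i, b (e i) = a i := by
  have hdeg : (∑ i, X ^ a i - ∑ j, X ^ b j : ℤ[X]).natDegree < n :=
    (natDegree_sub_le _ _).trans_lt
      (max_lt (natDegree_sum_X_pow_lt ha) (natDegree_sum_X_pow_lt hb))
  refine exists_equiv_of_sum_X_pow_eq
    (sub_eq_zero.mp (eq_zero_of_aeval_exp_eq_zero hdeg fun d hd => ?_))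
  simp only [map_sub, map_sum, map_pow, aeval_X, h d hd, sub_self]

theorem exists_equiv_of_sum_expChar_nsmul_eq {n : ℕ} [NeZero n] {a : ι → AddCircle (1 : ℚ)}
    {b : κ → AddCircle (1 : ℚ)} (ha : ∀ i, n • a i = 0) (hb : ∀ j, n • b j = 0)
    (h : ∀ c, c ∣ n → ∑ i, expChar (c • a i) = ∑ j, expChar (c • b j)) :
    ∃ e : ι ≃ κ, ∀ i, b (e i) = a i := by
  choose m hmn hm using fun i => exists_natCast_frac_eq (ha i)
  choose l hln hl using fun j => exists_natCast_frac_eq (hb j)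
  obtain ⟨e, he⟩ := exists_equiv_of_sum_exp_pow_eq hmn hln fun d ⟨c, hc⟩ => by
    have hn : n = c * d := hc.trans (mul_comm d c)
    have : NeZero c := ⟨left_ne_zero_of_mul (hn ▸ NeZero.ne n)⟩
    have hsum := h c ⟨d, hn⟩
    simpa only [← hm, ← hl, hn, nsmul_frac_mul, expChar_frac_natCast] using hsum
  exact ⟨e, fun i => by rw [← hm, ← hl, he]⟩

end ValueDistribution

theorem exists_equiv_of_gaussSum_eq {L M : TwoLinking.{u}}
    (h : ∀ k, L.gaussSum k = M.gaussSum k) :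
    ∃ τ : L.G ≃ M.G, ∀ x, M.form (τ x) (τ x) = L.form x x := by
  obtain ⟨l, hl⟩ := L.two_group
  obtain ⟨m, hm⟩ := M.two_group
  refine exists_equiv_of_sum_expChar_nsmul_eq (ι := L.G) (κ := M.G) (n := 2 ^ (l + m))
    (a := fun x => L.form x x) (b := fun x => M.form x x) (fun x => ?_) (fun x => ?_)
    fun c hc => ?_
  · rw [nsmul_form, pow_add, ← hl, mul_comm, mul_nsmul', card_nsmul_eq_zero]
    simp
  · rw [nsmul_form, pow_add, ← hm, mul_nsmul', card_nsmul_eq_zero]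
    simp
  · obtain ⟨j, -, rfl⟩ := (Nat.dvd_prime_pow Nat.prime_two).mp hc
    exact (L.gaussSum_succPNat j).symm.trans ((h _).trans (M.gaussSum_succPNat j))

/-! ### Perfect forms and orthogonal complements -/

section PerfectForm

variable {G H A : Type*} [AddCommGroup G] [AddCommGroup H] [AddCommGroup A]

/-- The pullback `(x, y) ↦ b(f x, f y)` of a bilinear form along a homomorphism. -/
def comapForm (f : H →+ G) (b : G →+ G →+ A) : H →+ H →+ A := (b.comp f).compl₂ f

@[simp]
theorem comapForm_apply (f : H →+ G) (b : G →+ G →+ A) (x y : H) :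
    comapForm f b x y = b (f x) (f y) := rfl

theorem comapForm_symm {f : H →+ G} {b : G →+ G →+ A} (hb : ∀ x y, b x y = b y x) (x y : H) :
    comapForm f b x y = comapForm f b y x := hb _ _

theorem comapForm_bijective (e : H ≃+ G) {b : G →+ G →+ A} (hb : Function.Bijective b) :
    Function.Bijective (comapForm e.toAddMonoidHom b) := by
  refine ⟨fun x y h => e.injective (hb.1 (AddMonoidHom.ext fun z => ?_)), fun χ => ?_⟩
  · simpa using DFunLike.congr_fun h (e.symm z)
  · obtain ⟨z, hz⟩ := hb.2 (χ.comp e.symm.toAddMonoidHom)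
    exact ⟨e.symm z, AddMonoidHom.ext fun w => by simp [hz]⟩

theorem bijective_right_of_sumForm {b : G →+ G →+ A} {c : H →+ H →+ A}
    (h : Function.Bijective (sumForm b c)) : Function.Bijective c := by
  refine ⟨fun x y hxy => ?_, fun χ => ?_⟩
  · have hsum : sumForm b c (0, x) = sumForm b c (0, y) := AddMonoidHom.ext fun z => by simp [hxy]
    exact congrArg Prod.snd (h.1 hsum)
  · obtain ⟨z, hz⟩ := h.2 (χ.comp (AddMonoidHom.snd G H))
    exact ⟨z.2, AddMonoidHom.ext fun w => by simpa using DFunLike.congr_fun hz (0, w)⟩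

/-- The orthogonal complement of the image of `f`. -/
def orthogonal (f : H →+ G) (b : G →+ G →+ A) : AddSubgroup G := (b.comp f).flip.ker

theorem mem_orthogonal {f : H →+ G} {b : G →+ G →+ A} {y : G} :
    y ∈ orthogonal f b ↔ ∀ x, b (f x) y = 0 := by
  rw [orthogonal, AddMonoidHom.mem_ker, DFunLike.ext_iff]
  rfl

variable {f : H →+ G} {b : G →+ G →+ A}

theorem coprod_orthogonal_bijective (hb : ∀ x y, b x y = b y x)
    (hf : Function.Bijective (comapForm f b)) :
    Function.Bijective (f.coprod (orthogonal f b).subtype) := by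
  refine ⟨(injective_iff_map_eq_zero _).mpr ?_, fun z => ?_⟩
  · rintro ⟨x, y⟩ h
    replace h : f x + y = 0 := h
    have hx : x = 0 := hf.1 (AddMonoidHom.ext fun x' => by
      have hx' : b (f x') (f x + y) = 0 := by rw [h, map_zero]
      rw [map_add, mem_orthogonal.mp y.2, add_zero, hb] at hx'
      simpa using hx')
    subst hx
    rw [map_zero, zero_add] at h
    exact Prod.ext rfl (Subtype.ext h)
  · obtain ⟨x, hx⟩ := hf.2 ((b z).comp f)
    have hx (x' : H) : b (f x) (f x') = b z (f x') := DFunLike.congr_fun hx x'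
    have hz : z - f x ∈ orthogonal f b := mem_orthogonal.mpr fun x' => by
      rw [map_sub, hb _ (f x), hx, hb, sub_self]
    exact ⟨(x, ⟨z - f x, hz⟩), add_sub_cancel _ _⟩

/-- The orthogonal splitting `H ⊕ H^⊥ ≃ G` for a subgroup on which the form is perfect. -/
noncomputable def orthogonalSplitting (hb : ∀ x y, b x y = b y x)
    (hf : Function.Bijective (comapForm f b)) : H × orthogonal f b ≃+ G :=
  AddEquiv.ofBijective _ (coprod_orthogonal_bijective hb hf)

theorem comapForm_orthogonalSplitting (hb : ∀ x y, b x y = b y x)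
    (hf : Function.Bijective (comapForm f b)) :
    comapForm (orthogonalSplitting hb hf).toAddMonoidHom b =
      sumForm (comapForm f b) (comapForm (orthogonal f b).subtype b) := by
  refine AddMonoidHom.ext fun p => AddMonoidHom.ext fun q => ?_
  change b (f p.1 + p.2) (f q.1 + q.2) = b (f p.1) (f q.1) + b p.2 q.2
  rw [map_add, map_add, AddMonoidHom.add_apply, AddMonoidHom.add_apply, mem_orthogonal.mp q.2.2,
    hb p.2 (f q.1), mem_orthogonal.mp p.2.2, zero_add, add_zero]

theorem comapForm_orthogonal_bijective (hb : ∀ x y, b x y = b y x) (hperf : Function.Bijective b)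
    (hf : Function.Bijective (comapForm f b)) :
    Function.Bijective (comapForm (orthogonal f b).subtype b) := by
  have h := comapForm_bijective (orthogonalSplitting hb hf) hperf
  rw [comapForm_orthogonalSplitting] at h
  exact bijective_right_of_sumForm h

end PerfectForm

section Complement

variable {B L : TwoLinking.{u}} (f : B.G →+ L.G) (hf : comapForm f L.form = B.form)

/-- The orthogonal complement of an isometrically embedded linking pairing. -/
noncomputable def complement : TwoLinking.{u} where
  G := orthogonal f L.form
  fin := Fintype.ofFinite _
  form := comapForm (orthogonal f L.form).subtype L.form
  symm := comapForm_symm L.symm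
  adjoint_bijective :=
    comapForm_orthogonal_bijective L.symm L.adjoint_bijective (hf ▸ B.adjoint_bijective)
  two_group := by
    obtain ⟨n, hn⟩ := L.two_group
    have hdvd := AddSubgroup.card_addSubgroup_dvd_card (orthogonal f L.form)
    rw [Nat.card_eq_fintype_card (α := L.G), hn] at hdvd
    obtain ⟨m, -, hm⟩ := (Nat.dvd_prime_pow Nat.prime_two).mp hdvd
    exact ⟨m, by rw [← hm, @Nat.card_eq_fintype_card _ (Fintype.ofFinite _)]⟩

theorem sum_complement_iso : Iso (B.sum (complement f hf)) L := by
  have hperf : Function.Bijective (comapForm f L.form) := hf ▸ B.adjoint_bijective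
  refine ⟨orthogonalSplitting L.symm hperf, fun p q => ?_⟩
  have h := comapForm_orthogonalSplitting L.symm hperf
  rw [hf] at h
  exact DFunLike.congr_fun (DFunLike.congr_fun h p) q

end Complement

/-! ### Forms with a given Gram matrix -/

section GramForm

variable {ι : Type*} [Fintype ι] {n : ℕ} [NeZero n]

/-- The bilinear form on `(ℤ/n)^ι` with a given Gram matrix. -/
noncomputable def gramForm (A : Matrix ι ι (ZMod n)) :
    (ι → ZMod n) →+ (ι → ZMod n) →+ AddCircle (1 : ℚ) where
  toFun v := (zmodFrac n).comp
    { toFun := fun w => v ⬝ᵥ A.mulVec w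
      map_zero' := by rw [Matrix.mulVec_zero, dotProduct_zero]
      map_add' := fun w w' => by rw [Matrix.mulVec_add, dotProduct_add] }
  map_zero' := AddMonoidHom.ext fun w => by simp
  map_add' v v' := AddMonoidHom.ext fun w => by simp [add_dotProduct]

theorem gramForm_apply (A : Matrix ι ι (ZMod n)) (v w : ι → ZMod n) :
    gramForm A v w = zmodFrac n (v ⬝ᵥ A.mulVec w) := rfl

theorem gramForm_symm {A : Matrix ι ι (ZMod n)} (hA : A.IsSymm) (v w : ι → ZMod n) :
    gramForm A v w = gramForm A w v := by
  rw [gramForm_apply, gramForm_apply, dotProduct_comm, ← Matrix.vecMul_transpose, hA.eq,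
    Matrix.dotProduct_mulVec]

theorem exists_zmodFrac_dotProduct_eq (χ : (ι → ZMod n) →+ AddCircle (1 : ℚ)) :
    ∃ c : ι → ZMod n, ∀ w, zmodFrac n (c ⬝ᵥ w) = χ w := by
  classical
  have hn (v : ι → ZMod n) : n • v = 0 := funext fun i => by simp
  choose c hc using fun i => exists_zmodFrac_eq (n := n) (a := χ (Pi.single i 1))
    (by rw [← map_nsmul, hn, map_zero])
  refine ⟨c, fun w => ?_⟩
  conv_rhs => rw [← Finset.univ_sum_single w]
  rw [dotProduct, map_sum, map_sum]
  refine Finset.sum_congr rfl fun i _ => ?_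
  rw [mul_comm, zmodFrac_mul, hc, ← map_nsmul, ← Pi.single_smul, nsmul_eq_mul,
    ZMod.natCast_zmod_val, mul_one]

theorem gramForm_bijective [DecidableEq ι] {A : Matrix ι ι (ZMod n)} (hA : IsUnit A.det) :
    Function.Bijective (gramForm A) := by
  refine ⟨(injective_iff_map_eq_zero _).mpr fun v hv => ?_, fun χ => ?_⟩
  · have hvA : Matrix.vecMul v A = 0 := dotProduct_eq_zero _ fun w => by
      rw [← Matrix.dotProduct_mulVec, ← zmodFrac_eq_zero_iff]
      exact DFunLike.congr_fun hv w
    have hv : Matrix.vecMul (Matrix.vecMul v A) A⁻¹ = v := by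
      rw [Matrix.vecMul_vecMul, Matrix.mul_nonsing_inv _ hA, Matrix.vecMul_one]
    rw [← hv, hvA, Matrix.zero_vecMul]
  · obtain ⟨c, hc⟩ := exists_zmodFrac_dotProduct_eq χ
    refine ⟨Matrix.vecMul c A⁻¹, AddMonoidHom.ext fun w => ?_⟩
    rw [gramForm_apply, Matrix.dotProduct_mulVec, Matrix.vecMul_vecMul,
      Matrix.nonsing_inv_mul _ hA, Matrix.vecMul_one, hc]

variable {G : Type*} [AddCommGroup G]

/-- The homomorphism `(ℤ/n)^ι → G` sending the standard basis to elements killed by `n`. -/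
def zmodPiHom (x : ι → G) (hx : ∀ i, n • x i = 0) : (ι → ZMod n) →+ G :=
  ∑ i, (ZMod.lift n ⟨zmultiplesHom G (x i), by simp [hx]⟩).comp (Pi.evalAddMonoidHom _ i)

theorem zmodPiHom_apply (x : ι → G) (hx : ∀ i, n • x i = 0) (v : ι → ZMod n) :
    zmodPiHom x hx v = ∑ i, (v i).val • x i := by
  rw [zmodPiHom, AddMonoidHom.finsetSum_apply]
  refine Finset.sum_congr rfl fun i _ => ?_
  have hv : v i = ((v i).val : ℤ) := by simp
  calc ZMod.lift n ⟨zmultiplesHom G (x i), by simp [hx]⟩ (v i)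
      = zmultiplesHom G (x i) ((v i).val : ℤ) := (congrArg _ hv).trans (ZMod.lift_coe _ _ _)
    _ = (v i).val • x i := natCast_zsmul _ _

theorem comapForm_zmodPiHom {x : ι → G} (hx : ∀ i, n • x i = 0)
    {b : G →+ G →+ AddCircle (1 : ℚ)} {A : Matrix ι ι (ZMod n)}
    (hA : ∀ i j, b (x i) (x j) = zmodFrac n (A i j)) :
    comapForm (zmodPiHom x hx) b = gramForm A := by
  refine AddMonoidHom.ext fun v => AddMonoidHom.ext fun w => ?_
  simp only [comapForm_apply, gramForm_apply, zmodPiHom_apply, map_sum, map_nsmul, dotProduct,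
    AddMonoidHom.finsetSum_apply, AddMonoidHom.nsmul_apply, hA, Matrix.mulVec, Finset.mul_sum]
  rw [Finset.sum_comm]
  refine Finset.sum_congr rfl fun i _ => ?_
  rw [Finset.smul_sum]
  refine Finset.sum_congr rfl fun j _ => ?_
  rw [zmodFrac_mul, mul_comm, zmodFrac_mul, smul_comm]

end GramForm

theorem exists_eq_nsmul_of_nsmul_eq_zero {a b c : ℕ} [NeZero a] (h : a * b = c) {z : ZMod c}
    (hz : a • z = 0) : ∃ w : ZMod c, z = b • w := by
  obtain ⟨m, rfl⟩ := ZMod.intCast_surjective z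
  rw [nsmul_eq_mul, ← Int.cast_natCast, ← Int.cast_mul, ZMod.intCast_zmod_eq_zero_iff_dvd, ← h,
    Nat.cast_mul] at hz
  obtain ⟨k, rfl⟩ := (mul_dvd_mul_iff_left (NeZero.ne (a : ℤ))).mp hz
  exact ⟨k, by simp⟩

/-- The linking pairing on `(ℤ/2^N)^r` with a given symmetric invertible Gram matrix. -/
noncomputable def block (N r : ℕ) (A : Matrix (Fin r) (Fin r) (ZMod (2 ^ N))) (hs : A.IsSymm)
    (hA : IsUnit A.det) : TwoLinking.{u} where
  G := ULift.{u} (Fin r → ZMod (2 ^ N))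
  form := comapForm AddEquiv.ulift.toAddMonoidHom (gramForm A)
  symm := comapForm_symm (gramForm_symm hs)
  adjoint_bijective :=
    comapForm_bijective (AddEquiv.ulift (α := Fin r → ZMod (2 ^ N))) (gramForm_bijective hA)
  two_group := ⟨N * r, by
    rw [Fintype.card_ulift, Fintype.card_fun, ZMod.card, Fintype.card_fin, ← pow_mul]⟩

section Block

variable {N r : ℕ} {A : Matrix (Fin r) (Fin r) (ZMod (2 ^ N))} {hs : A.IsSymm}
  {hA : IsUnit A.det}

theorem block_form (x y : (block.{u} N r A hs hA).G) :
    (block.{u} N r A hs hA).form x y = zmodFrac (2 ^ N) (x.down ⬝ᵥ A.mulVec y.down) := rfl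

theorem card_block : Nat.card (block.{u} N r A hs hA).G = 2 ^ (N * r) := by
  refine (Nat.card_congr Equiv.ulift).trans ?_
  rw [Nat.card_eq_fintype_card, Fintype.card_fun, ZMod.card, Fintype.card_fin, ← pow_mul]

theorem one_lt_card_block (hN : 0 < N) (hr : 0 < r) : 1 < Nat.card (block.{u} N r A hs hA).G :=
  card_block.symm ▸ Nat.one_lt_two_pow (Nat.mul_pos hN hr).ne'

theorem two_pow_nsmul_block (x : (block.{u} N r A hs hA).G) : 2 ^ N • x = 0 :=
  ULift.down_injective (funext fun i =>
    show 2 ^ N • x.down i = 0 by rw [nsmul_eq_mul, ZMod.natCast_self, zero_mul])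

theorem exists_eq_nsmul_block {a b : ℕ} [NeZero a] (hab : a * b = 2 ^ N)
    {x : (block.{u} N r A hs hA).G} (hx : a • x = 0) : ∃ y, x = b • y := by
  choose y hy using fun i =>
    exists_eq_nsmul_of_nsmul_eq_zero hab (congrFun (congrArg ULift.down hx) i)
  exact ⟨ULift.up y, ULift.down_injective (funext hy)⟩

theorem gaussSum_block_ne_zero {n : ℕ} (h : n + 1 ≠ N) :
    (block.{u} N r A hs hA).gaussSum n.succPNat ≠ 0 := by
  rw [gaussSum_ne_zero_iff]
  intro z hz
  rcases lt_or_gt_of_ne h with hlt | hgt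
  · obtain ⟨d, rfl⟩ := Nat.exists_eq_add_of_lt hlt
    obtain ⟨y, hy⟩ := exists_eq_nsmul_block (b := 2 ^ (d + 1)) (by rw [← pow_add]; rfl) hz
    have hzero : 2 ^ (d + 1) • 2 ^ n • z = 0 := by
      have hpow : 2 ^ (d + 1) * 2 ^ n = 2 ^ d * 2 ^ (n + 1) := by ring
      rw [← mul_smul, hpow, mul_smul, hz, smul_zero]
    conv_lhs => arg 2; arg 2; rw [hy]
    rw [nsmul_form, map_nsmul, nsmul_form, hzero, map_zero, AddMonoidHom.zero_apply]
  · obtain ⟨d, rfl⟩ := Nat.exists_eq_add_of_le (Nat.lt_succ_iff.mp hgt)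
    rw [nsmul_form, add_comm, pow_add, mul_smul, two_pow_nsmul_block, smul_zero, map_zero,
      AddMonoidHom.zero_apply]

theorem exists_hom_block {L : TwoLinking.{u}} {x : Fin r → L.G} (hx : ∀ i, 2 ^ N • x i = 0)
    (hform : ∀ i j, L.form (x i) (x j) = zmodFrac (2 ^ N) (A i j)) :
    ∃ f : (block.{u} N r A hs hA).G →+ L.G, comapForm f L.form = (block.{u} N r A hs hA).form ∧
      ∀ v, f v = ∑ i, (v.down i).val • x i := by
  refine ⟨(zmodPiHom x hx).comp (AddEquiv.ulift (α := Fin r → ZMod (2 ^ N))).toAddMonoidHom,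
    ?_, fun v => zmodPiHom_apply x hx v.down⟩
  exact congrArg (comapForm AddEquiv.ulift.toAddMonoidHom) (comapForm_zmodPiHom hx hform)

end Block

/-! ### Vectors of maximal order -/

theorem exists_exponent (L : TwoLinking.{u}) [Nontrivial L.G] :
    ∃ n, (∀ x : L.G, 2 ^ (n + 1) • x = 0) ∧ ∃ x : L.G, 2 ^ n • x ≠ 0 := by
  obtain ⟨a, ha⟩ := L.two_group
  have h0 : ¬ ∀ x : L.G, 2 ^ 0 • x = 0 := by
    simpa using exists_ne (0 : L.G)
  obtain ⟨n, hn, hn'⟩ := Nat.exists_not_and_succ_of_not_zero_of_exists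
    (p := fun n => ∀ x : L.G, 2 ^ n • x = 0) h0 ⟨a, fun x => by rw [← ha, card_nsmul_eq_zero]⟩
  exact ⟨n, hn', not_forall.mp hn⟩

/-- There is an isotropic vector not killed by `2 ^ n`. -/
def HasIsotropicAt (L : TwoLinking.{u}) (n : ℕ) : Prop := ∃ x, 2 ^ n • x ≠ 0 ∧ L.form x x = 0

theorem exists_quadratic_root {b t : ℤ} (c : ℤ) (hb : Odd b) (ht : Even t) (j : ℕ) :
    ∃ α : ℤ, (2 : ℤ) ^ j ∣ t + b * α + c * α ^ 2 := by
  suffices h : ∃ α : ℤ, (2 : ℤ) ^ (j + 1) ∣ t + b * α + c * α ^ 2 by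
    obtain ⟨α, hα⟩ := h
    exact ⟨α, (pow_dvd_pow 2 (Nat.le_succ j)).trans hα⟩
  induction j with
  | zero => exact ⟨0, by simpa using even_iff_two_dvd.mp ht⟩
  | succ j ih =>
    obtain ⟨α, d, hd⟩ := ih
    obtain ⟨e, rfl⟩ := hb
    exact ⟨α + d * 2 ^ (j + 1), d * (e + 1 + α * c + c * d * 2 ^ j), by
      linear_combination hd⟩

section Vectors

variable {L : TwoLinking.{u}} {n : ℕ}

theorem nsmul_ne_zero_of_form_ne_zero {x y : L.G} (h : 2 ^ n • L.form x y ≠ 0) : 2 ^ n • x ≠ 0 :=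
  fun hx => h (by rw [nsmul_form, hx, map_zero, AddMonoidHom.zero_apply])

theorem nsmul_form_ne_zero {x y : L.G} (h : L.form x y = frac (2 ^ (n + 1)) 1) :
    2 ^ n • L.form x y ≠ 0 := by
  rw [h, Ne, two_pow_nsmul_frac_succ_eq_zero_iff]
  decide

theorem exists_odd_form_eq (hL : ∀ x : L.G, 2 ^ (n + 1) • x = 0) {x y : L.G}
    (h : 2 ^ n • L.form x y ≠ 0) : ∃ m, Odd m ∧ L.form x y = frac (2 ^ (n + 1)) m := by
  obtain ⟨m, hm⟩ := exists_frac_eq (n := 2 ^ (n + 1)) (a := L.form x y)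
    (by rw [nsmul_form, hL, map_zero, AddMonoidHom.zero_apply])
  rw [← hm, Ne, two_pow_nsmul_frac_succ_eq_zero_iff, Int.not_even_iff_odd] at h
  exact ⟨m, h, hm.symm⟩

theorem exists_form_eq_frac_one (hL : ∀ x : L.G, 2 ^ (n + 1) • x = 0) {x : L.G}
    (hx : 2 ^ n • x ≠ 0) : ∃ y, L.form x y = frac (2 ^ (n + 1)) 1 := by
  obtain ⟨y, hy⟩ := not_forall.mp (mt L.form_eq_zero_iff.mp hx)
  obtain ⟨m, hodd, hm⟩ := exists_odd_form_eq hL (nsmul_form L _ x y ▸ hy)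
  obtain ⟨a, b, hab⟩ : IsCoprime m (2 ^ (n + 1)) := (Int.isCoprime_two_right.mpr hodd).pow_right
  refine ⟨a • y, ?_⟩
  rw [map_zsmul, hm, zsmul_frac, frac_eq_frac_iff]
  exact ⟨-b, by push_cast; linear_combination hab⟩

theorem form_comb_self {x y : L.G} {a c : ℤ} (hxx : L.form x x = frac (2 ^ n) a)
    (hxy : L.form x y = frac (2 ^ (n + 1)) 1) (hyy : L.form y y = frac (2 ^ n) c) (α β : ℤ) :
    L.form (α • x + β • y) (α • x + β • y) = frac (2 ^ n) (α ^ 2 * a + α * β + β ^ 2 * c) := by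
  have hxy2 : 2 • L.form x y = frac (2 ^ n) 1 := by rw [hxy, pow_succ', nsmul_frac_mul]
  rw [form_add_self L.symm]
  simp only [map_zsmul, AddMonoidHom.zsmul_apply, hxx, hyy, smul_comm (2 : ℕ), hxy2, zsmul_frac]
  rw [← map_add, ← map_add]
  congr 1
  ring

theorem IsEvenAt.exists_form_self_eq (heven : L.IsEvenAt n) (x : L.G) :
    ∃ a, L.form x x = frac (2 ^ n) a := by
  obtain ⟨a, ha⟩ := exists_frac_eq (n := 2 ^ n) (heven x)
  exact ⟨a, ha.symm⟩

theorem IsEvenAt.nsmul_form_add_zsmul (heven : L.IsEvenAt n) (x y : L.G) (α : ℤ) :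
    2 ^ n • L.form (x + α • y) y = 2 ^ n • L.form x y := by
  rw [map_add, map_zsmul, AddMonoidHom.add_apply, AddMonoidHom.zsmul_apply, smul_add, smul_comm,
    heven, smul_zero, add_zero]

theorem IsEvenAt.exists_hyperbolic_pair (heven : L.IsEvenAt n)
    (hL : ∀ x : L.G, 2 ^ (n + 1) • x = 0) (hiso : L.HasIsotropicAt n) :
    ∃ x y, L.form x x = 0 ∧ L.form x y = frac (2 ^ (n + 1)) 1 ∧ L.form y y = 0 := by
  obtain ⟨x, hx, hxx⟩ := hiso
  obtain ⟨y, hy⟩ := exists_form_eq_frac_one hL hx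
  obtain ⟨c, hc⟩ := heven.exists_form_self_eq y
  refine ⟨x, (-c) • x + (1 : ℤ) • y, hxx, ?_, ?_⟩
  · rw [map_add, map_zsmul, map_zsmul, hxx, smul_zero, zero_add, one_smul, hy]
  · rw [form_comb_self (hxx.trans (map_zero (frac (2 ^ n))).symm) hy hc]
    ring_nf
    exact map_zero _

theorem IsEvenAt.hasIsotropicAt (heven : L.IsEvenAt n) (hL : ∀ x : L.G, 2 ^ (n + 1) • x = 0)
    {z : L.G} (hz : 2 ^ n • z ≠ 0) {b : ℤ} (hzz : L.form z z = frac (2 ^ n) b) (hb : Even b) :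
    L.HasIsotropicAt n := by
  obtain ⟨y, hy⟩ := exists_form_eq_frac_one hL hz
  obtain ⟨c, hc⟩ := heven.exists_form_self_eq y
  obtain ⟨α, hα⟩ := exists_quadratic_root c odd_one hb n
  refine ⟨z + α • y, nsmul_ne_zero_of_form_ne_zero (y := y) ?_, ?_⟩
  · rw [heven.nsmul_form_add_zsmul]
    exact nsmul_form_ne_zero hy
  · rw [← one_zsmul z, form_comb_self hzz hy hc, frac_eq_zero_iff]
    convert hα using 1
    · push_cast; rfl
    · ring

theorem IsEvenAt.odd_of_not_hasIsotropicAt (heven : L.IsEvenAt n)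
    (hL : ∀ x : L.G, 2 ^ (n + 1) • x = 0) (hani : ¬ L.HasIsotropicAt n) {z : L.G}
    (hz : 2 ^ n • z ≠ 0) {b : ℤ} (hzz : L.form z z = frac (2 ^ n) b) : Odd b :=
  Int.not_even_iff_odd.mp fun hb => hani (heven.hasIsotropicAt hL hz hzz hb)

theorem IsEvenAt.exists_form_self_eq_frac_one (heven : L.IsEvenAt n)
    (hL : ∀ x : L.G, 2 ^ (n + 1) • x = 0) (hani : ¬ L.HasIsotropicAt n)
    (htop : ∃ x : L.G, 2 ^ n • x ≠ 0) : ∃ x, 2 ^ n • x ≠ 0 ∧ L.form x x = frac (2 ^ n) 1 := by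
  obtain ⟨x, hx⟩ := htop
  obtain ⟨y, hxy⟩ := exists_form_eq_frac_one hL hx
  obtain ⟨c, hyy⟩ := heven.exists_form_self_eq y
  obtain ⟨a, hxx⟩ := heven.exists_form_self_eq x
  have ha : Odd a := heven.odd_of_not_hasIsotropicAt hL hani hx hxx
  obtain ⟨α, hα⟩ := exists_quadratic_root c odd_one (ha.sub_odd odd_one) n
  refine ⟨x + α • y, nsmul_ne_zero_of_form_ne_zero (y := y) ?_, ?_⟩
  · rw [heven.nsmul_form_add_zsmul]
    exact nsmul_form_ne_zero hxy
  · rw [← one_zsmul x, form_comb_self hxx hxy hyy, frac_eq_frac_iff]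
    convert hα using 1
    · push_cast; rfl
    · ring

theorem IsEvenAt.exists_anisotropic_pair (heven : L.IsEvenAt n)
    (hL : ∀ x : L.G, 2 ^ (n + 1) • x = 0) (hani : ¬ L.HasIsotropicAt n)
    (htop : ∃ x : L.G, 2 ^ n • x ≠ 0) :
    ∃ x y, L.form x x = frac (2 ^ n) 1 ∧ L.form x y = frac (2 ^ (n + 1)) 1 ∧
      L.form y y = frac (2 ^ n) 1 := by
  obtain ⟨x, hx, hxx⟩ := heven.exists_form_self_eq_frac_one hL hani htop
  obtain ⟨y, hxy⟩ := exists_form_eq_frac_one hL hx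
  obtain ⟨c, hyy⟩ := heven.exists_form_self_eq y
  have hy : 2 ^ n • y ≠ 0 := nsmul_ne_zero_of_form_ne_zero (nsmul_form_ne_zero
    ((L.symm y x).trans hxy))
  have hc : Odd c := heven.odd_of_not_hasIsotropicAt hL hani hy hyy
  -- The vectors `β x + (1 - 2 β) y` are those of the plane pairing to `1 / 2 ^ (n + 1)` with `x`.
  obtain ⟨β, hβ⟩ := exists_quadratic_root (b := 1 - 4 * c) (4 * c - 1) ⟨-2 * c, by ring⟩
    (hc.sub_odd odd_one) n
  refine ⟨x, β • x + (1 - 2 * β) • y, hxx, ?_, ?_⟩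
  · rw [map_add, map_zsmul, map_zsmul, hxx, hxy, ← frac_two_pow_succ_two_mul, zsmul_frac,
      zsmul_frac, ← map_add]
    congr 1
    ring
  · rw [form_comb_self hxx hxy hyy, frac_eq_frac_iff]
    convert hβ using 1
    · push_cast; rfl
    · ring

end Vectors

/-! ### Torsion and multiples -/

section Multiples

variable {A B : Type*} [AddCommGroup A] [AddCommGroup B]

theorem torsionCard_congr (e : A ≃+ B) (n : ℕ) : torsionCard A n = torsionCard B n :=
  Nat.card_congr (e.toEquiv.subtypeEquiv fun x => by
    rw [← e.map_eq_zero_iff, map_nsmul]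
    rfl)

theorem torsionCard_prod (A B : Type*) [AddCommGroup A] [AddCommGroup B] (n : ℕ) :
    torsionCard (A × B) n = torsionCard A n * torsionCard B n := by
  rw [torsionCard, torsionCard, torsionCard, ← Nat.card_prod]
  exact Nat.card_congr ((Equiv.subtypeEquivRight fun x => by
    rw [Prod.ext_iff]
    rfl).trans (Equiv.subtypeProdEquivProd (p := fun x : A => n • x = 0)))

/-- The order of the subgroup `n A` of multiples of `n`. -/
noncomputable def multipleCard (A : Type*) [AddCommGroup A] (n : ℕ) : ℕ :=
  Nat.card (nsmulAddMonoidHom n : A →+ A).range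

theorem torsionCard_mul_multipleCard (A : Type*) [AddCommGroup A] (n : ℕ) :
    torsionCard A n * multipleCard A n = Nat.card A := by
  rw [multipleCard, ← AddSubgroup.index_ker]
  exact (nsmulAddMonoidHom n : A →+ A).ker.card_mul_index

theorem multipleCard_eq_one_iff {n : ℕ} : multipleCard A n = 1 ↔ ∀ x : A, n • x = 0 := by
  rw [multipleCard, AddSubgroup.card_eq_one, AddMonoidHom.range_eq_bot_iff, DFunLike.ext_iff]
  rfl

variable [Finite A]

theorem multipleCard_pos (n : ℕ) : 0 < multipleCard A n := Nat.card_pos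

theorem multipleCard_eq_of_torsionCard_eq {n : ℕ} (ht : torsionCard A n = torsionCard B n)
    (hc : Nat.card A = Nat.card B) : multipleCard A n = multipleCard B n := by
  refine Nat.eq_of_mul_eq_mul_left (torsionCard_pos A n) ?_
  rw [torsionCard_mul_multipleCard, ht, torsionCard_mul_multipleCard, hc]

theorem multipleCard_prod [Finite B] (n : ℕ) :
    multipleCard (A × B) n = multipleCard A n * multipleCard B n := by
  refine Nat.eq_of_mul_eq_mul_left (torsionCard_pos (A × B) n) ?_
  rw [torsionCard_mul_multipleCard, torsionCard_prod, mul_mul_mul_comm,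
    torsionCard_mul_multipleCard, torsionCard_mul_multipleCard, Nat.card_prod]

theorem nsmul_eq_nsmul_of_multipleCard_le_two {n : ℕ} (h : multipleCard A n ≤ 2) {x y : A}
    (hx : n • x ≠ 0) (hy : n • y ≠ 0) : n • x = n • y := by
  by_contra hxy
  refine h.not_gt ((Set.two_lt_ncard_iff (Set.toFinite _)).mpr ⟨0, n • x, n • y, zero_mem _, ?_⟩)
  exact ⟨⟨x, rfl⟩, ⟨y, rfl⟩, hx.symm, hy.symm, hxy⟩

end Multiples

theorem exists_multipleCard_eq_two_pow (L : TwoLinking.{u}) (n : ℕ) :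
    ∃ i, multipleCard L.G n = 2 ^ i := by
  obtain ⟨a, ha⟩ := L.two_group
  obtain ⟨i, -, hi⟩ := (Nat.dvd_prime_pow Nat.prime_two).mp
    (ha ▸ Nat.card_eq_fintype_card (α := L.G) ▸
      (torsionCard_mul_multipleCard L.G n ▸ dvd_mul_left _ _))
  exact ⟨i, hi⟩

theorem four_le_multipleCard {L : TwoLinking.{u}} {n : ℕ} (h : 2 < multipleCard L.G n) :
    4 ≤ multipleCard L.G n := by
  obtain ⟨i, hi⟩ := L.exists_multipleCard_eq_two_pow n
  rw [hi] at h ⊢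
  exact Nat.pow_le_pow_right (n := 2) (i := 2) two_pos
    ((Nat.pow_lt_pow_iff_right one_lt_two (n := 1)).mp h)

section Parity

variable {L : TwoLinking.{u}} {n : ℕ}

theorem isEvenAt_of_two_pow_nsmul_eq_zero (h : ∀ x : L.G, 2 ^ n • x = 0) : L.IsEvenAt n :=
  fun x => by rw [nsmul_form, h, map_zero, AddMonoidHom.zero_apply]

theorem IsEvenAt.four_le_multipleCard (heven : L.IsEvenAt n)
    (hL : ∀ x : L.G, 2 ^ (n + 1) • x = 0) (htop : ∃ x : L.G, 2 ^ n • x ≠ 0) :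
    4 ≤ multipleCard L.G (2 ^ n) := by
  obtain ⟨x, hx⟩ := htop
  obtain ⟨y, hy⟩ := exists_form_eq_frac_one hL hx
  refine TwoLinking.four_le_multipleCard (not_le.mp fun hle => nsmul_form_ne_zero hy ?_)
  have hytop : 2 ^ n • y ≠ 0 :=
    nsmul_ne_zero_of_form_ne_zero (nsmul_form_ne_zero ((L.symm y x).trans hy))
  rw [← map_nsmul, ← nsmul_eq_nsmul_of_multipleCard_le_two hle hx hytop, map_nsmul, heven]

theorem isEvenAt_iff_multipleCard_eq_one (hL : ∀ x : L.G, 2 ^ (n + 1) • x = 0)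
    (h : multipleCard L.G (2 ^ n) < 4) : L.IsEvenAt n ↔ multipleCard L.G (2 ^ n) = 1 := by
  rw [multipleCard_eq_one_iff]
  refine ⟨fun heven => ?_, isEvenAt_of_two_pow_nsmul_eq_zero⟩
  by_contra! htop
  exact (heven.four_le_multipleCard hL htop).not_gt h

theorem gaussSum_eq_zero_iff (hL : ∀ x : L.G, 2 ^ (n + 1) • x = 0) :
    L.gaussSum n.succPNat = 0 ↔ ¬ L.IsEvenAt n := by
  rw [← not_ne_iff, gaussSum_ne_zero_iff]
  exact not_congr (forall_congr' fun x => forall_prop_of_true (hL x))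

end Parity

/-! ### Counting vectors -/

theorem card_le_two_mul_card_filter {G : Type*} [Add G] [IsRightCancelAdd G] {s : Finset G}
    {p : G → Prop} [DecidablePred p] (t : G) (h : ∀ z ∈ s, ¬ p z → z + t ∈ s ∧ p (z + t)) :
    s.card ≤ 2 * (s.filter p).card := by
  have htranslate : (s.filter fun z => ¬ p z).card ≤ (s.filter p).card :=
    Finset.card_le_card_of_injOn (· + t)
      (fun z hz => Finset.mem_coe.mpr (Finset.mem_filter.mpr
        (h z (Finset.mem_filter.mp hz).1 (Finset.mem_filter.mp hz).2)))
      (add_left_injective t).injOn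
  have hsplit := s.card_filter_add_card_filter_not p
  lia

section Counting

variable {L : TwoLinking.{u}} {m : ℕ}

/-- The number of vectors on which `2 ^ m λ(x, x)` vanishes. -/
noncomputable def nullCard (L : TwoLinking.{u}) (m : ℕ) : ℕ :=
  Nat.card {z : L.G // 2 ^ m • L.form z z = 0}

/-- Half of the vectors `z` pair nontrivially with the isotropic vector `x`; on those, translation
by `x` switches the value of `2 ^ m λ(z, z)` between `0` and `1 / 2`. -/
theorem card_lt_four_mul_nullCard (hL : ∀ x : L.G, 2 ^ (m + 2) • x = 0)
    (heven : L.IsEvenAt (m + 1)) (hiso : L.HasIsotropicAt (m + 1)) :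
    Nat.card L.G < 4 * L.nullCard m := by
  classical
  obtain ⟨x, hx, hxx⟩ := hiso
  obtain ⟨y, hy⟩ := exists_form_eq_frac_one hL hx
  have hhalf (z : L.G) (hz : 2 ^ (m + 1) • L.form z x ≠ 0) :
      2 ^ (m + 1) • L.form z x = frac 2 1 := by
    refine eq_frac_two_one ?_ hz
    rw [← mul_nsmul', ← pow_succ', nsmul_form, hL, map_zero, AddMonoidHom.zero_apply]
  have hnull (z : L.G) (hz : 2 ^ m • L.form z z ≠ 0) : 2 ^ m • L.form z z = frac 2 1 :=
    eq_frac_two_one (by rw [← mul_nsmul', ← pow_succ', heven]) hz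
  let T := Finset.univ.filter fun z : L.G => 2 ^ (m + 1) • L.form z x ≠ 0
  have hT : (Finset.univ : Finset L.G).card ≤ 2 * T.card := by
    refine card_le_two_mul_card_filter y fun z _ hz => ⟨Finset.mem_univ _, ?_⟩
    rw [map_add, AddMonoidHom.add_apply, nsmul_add, not_not.mp hz, zero_add, L.symm]
    exact nsmul_form_ne_zero hy
  have hTnull : T.card ≤ 2 * (T.filter fun z => 2 ^ m • L.form z z = 0).card := by
    refine card_le_two_mul_card_filter x fun z hz hzz => ⟨Finset.mem_filter.mpr ?_, ?_⟩
    · refine ⟨Finset.mem_univ _, ?_⟩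
      rw [map_add, AddMonoidHom.add_apply, hxx, add_zero]
      exact (Finset.mem_filter.mp hz).2
    · rw [form_add_self L.symm, hxx, add_zero, nsmul_add, ← mul_nsmul', ← pow_succ, hnull z hzz,
        hhalf z (Finset.mem_filter.mp hz).2, ← map_add, frac_eq_zero_iff]
      decide
  have hlt : (T.filter fun z => 2 ^ m • L.form z z = 0).card < L.nullCard m := by
    rw [nullCard, Nat.card_eq_fintype_card, Fintype.card_subtype]
    refine Finset.card_lt_card ((Finset.ssubset_iff_of_subset
      (Finset.filter_subset_filter _ (Finset.filter_subset _ _))).mpr ⟨0, ?_, ?_⟩)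
    · simp
    · simp
  rw [Nat.card_eq_fintype_card, ← Finset.card_univ]
  lia

theorem four_mul_nullCard_le_card (hL : ∀ x : L.G, 2 ^ (m + 2) • x = 0)
    (heven : L.IsEvenAt (m + 1)) (hani : ¬ L.HasIsotropicAt (m + 1))
    (htop : ∃ x : L.G, 2 ^ (m + 1) • x ≠ 0) : 4 * L.nullCard m ≤ Nat.card L.G := by
  have hnull : L.nullCard m ≤ torsionCard L.G (2 ^ (m + 1)) := by
    refine Nat.card_le_card_of_injective _
      (Subtype.impEmbedding _ _ fun z (hz : 2 ^ m • L.form z z = 0) => ?_).injective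
    by_contra hztop
    obtain ⟨b, hb⟩ := heven.exists_form_self_eq z
    rw [hb, two_pow_nsmul_frac_succ_eq_zero_iff] at hz
    exact Int.not_even_iff_odd.mpr (heven.odd_of_not_hasIsotropicAt hL hani hztop hb) hz
  rw [← torsionCard_mul_multipleCard L.G (2 ^ (m + 1)), mul_comm]
  exact Nat.mul_le_mul hnull (heven.four_le_multipleCard hL htop)

end Counting

/-! ### Characteristic vectors -/

/-- Vectors `x` with `2 ^ n λ(x, y) = 2 ^ n λ(y, y)` for all `y`. A cyclic summand generated by
`x` has an even orthogonal complement only if `x` is characteristic. -/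
def IsCharacteristic (L : TwoLinking.{u}) (n : ℕ) (x : L.G) : Prop :=
  ∀ y, 2 ^ n • L.form x y = 2 ^ n • L.form y y

theorem card_isCharacteristic_le (L : TwoLinking.{u}) (n : ℕ) :
    Nat.card {x // L.IsCharacteristic n x} ≤ torsionCard L.G (2 ^ n) := by
  rcases isEmpty_or_nonempty {x // L.IsCharacteristic n x} with _ | ⟨x₀, hx₀⟩
  · simp
  · refine Nat.card_le_card_of_injective
      (Subtype.map (p := L.IsCharacteristic n) (q := fun z : L.G => 2 ^ n • z = 0)
        (· - x₀) fun x hx => ?_) (Subtype.map_injective _ (sub_left_injective (b := x₀)))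
    refine L.form_eq_zero_iff.mp fun y => ?_
    rw [← nsmul_form, map_sub, AddMonoidHom.sub_apply, smul_sub, hx y, hx₀ y, sub_self]

theorem card_le_two_mul_card_odd {L : TwoLinking.{u}} {n : ℕ}
    (hL : ∀ x : L.G, 2 ^ (n + 1) • x = 0) (hodd : ¬ L.IsEvenAt n) :
    Nat.card L.G ≤ 2 * Nat.card {x // 2 ^ n • L.form x x ≠ 0} := by
  classical
  obtain ⟨x₀, hx₀⟩ := not_forall.mp hodd
  rw [Nat.card_eq_fintype_card, Nat.card_eq_fintype_card, Fintype.card_subtype,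
    ← Finset.card_univ]
  refine card_le_two_mul_card_filter x₀ fun z _ hz => ⟨Finset.mem_univ _, ?_⟩
  rw [form_add_self L.symm, nsmul_add, ← mul_nsmul', ← pow_succ, nsmul_form _ (2 ^ (n + 1)), hL,
    map_zero, AddMonoidHom.zero_apply, add_zero, nsmul_add, not_not.mp hz, zero_add]
  exact hx₀

theorem exists_not_isCharacteristic {L M : TwoLinking.{u}} {n : ℕ}
    (hL : ∀ x : L.G, 2 ^ (n + 1) • x = 0) (hodd : ¬ L.IsEvenAt n) (τ : L.G ≃ M.G)
    (hcardL : 8 ≤ multipleCard L.G (2 ^ n)) (hcardM : 8 ≤ multipleCard M.G (2 ^ n)) :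
    ∃ x, 2 ^ n • L.form x x ≠ 0 ∧ ¬ L.IsCharacteristic n x ∧ ¬ M.IsCharacteristic n (τ x) := by
  classical
  by_contra! hcon
  have hcover : Nat.card {x // 2 ^ n • L.form x x ≠ 0} ≤
      Nat.card {x // L.IsCharacteristic n x} + Nat.card {x // M.IsCharacteristic n (τ x)} := by
    simp only [Nat.card_eq_fintype_card]
    refine le_trans ?_ (Fintype.card_subtype_or _ _)
    exact Fintype.card_subtype_mono _ _ fun x hx => or_iff_not_imp_left.mpr (hcon x hx)
  have hτ : Nat.card {x // M.IsCharacteristic n (τ x)} = Nat.card {x // M.IsCharacteristic n x} :=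
    Nat.card_congr (τ.subtypeEquiv fun _ => Iff.rfl)
  have hL8 := Nat.mul_le_mul_left (torsionCard L.G (2 ^ n)) hcardL
  have hM8 := Nat.mul_le_mul_left (torsionCard M.G (2 ^ n)) hcardM
  rw [torsionCard_mul_multipleCard] at hL8 hM8
  have hLchar := L.card_isCharacteristic_le n
  have hMchar := M.card_isCharacteristic_le n
  have hLM : Nat.card L.G = Nat.card M.G := Nat.card_congr τ
  have hhalf := card_le_two_mul_card_odd hL hodd
  have hpos : 0 < Nat.card L.G := Nat.card_pos
  lia

/-! ### Cyclic and binary blocks -/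

theorem isUnit_intCast_zmod_two_pow {m : ℤ} (hm : Odd m) (N : ℕ) :
    IsUnit (m : ZMod (2 ^ N)) := by
  rw [ZMod.coe_int_isUnit_iff_isCoprime, Nat.cast_pow]
  exact (Int.isCoprime_two_left.mpr hm).pow_left

/-- An isometric embedding of `B` into `L` exists. -/
def Embeds (B L : TwoLinking.{u}) : Prop := ∃ f : B.G →+ L.G, comapForm f L.form = B.form

theorem Embeds.exists_iso_sum {B L : TwoLinking.{u}} (h : Embeds B L) :
    ∃ L', Iso (B.sum L') L := by
  obtain ⟨f, hf⟩ := h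
  exact ⟨complement f hf, sum_complement_iso f hf⟩

/-- The symmetric binary matrix with even diagonal `2 a`, `2 c` and off-diagonal entry `1`. -/
def binaryGram (N : ℕ) (a c : ℤ) : Matrix (Fin 2) (Fin 2) (ZMod (2 ^ N)) :=
  !![((2 * a : ℤ) : ZMod (2 ^ N)), 1; 1, ((2 * c : ℤ) : ZMod (2 ^ N))]

theorem binaryGram_isSymm (N : ℕ) (a c : ℤ) : (binaryGram N a c).IsSymm :=
  Matrix.IsSymm.ext fun i j => by fin_cases i <;> fin_cases j <;> rfl

theorem isUnit_det_binaryGram (N : ℕ) (a c : ℤ) : IsUnit (binaryGram N a c).det := by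
  have hdet : (binaryGram N a c).det = ((4 * a * c - 1 : ℤ) : ZMod (2 ^ N)) := by
    rw [binaryGram, Matrix.det_fin_two_of]
    push_cast
    ring
  rw [hdet]
  exact isUnit_intCast_zmod_two_pow ⟨2 * a * c - 1, by ring⟩ N

/-- The even plane `λ(x, x) = a / 2 ^ n`, `λ(x, y) = 1 / 2 ^ (n + 1)`, `λ(y, y) = c / 2 ^ n`. It is
hyperbolic for `a = c = 0` and anisotropic for `a = c = 1`. -/
noncomputable def binaryBlock (n : ℕ) (a c : ℤ) : TwoLinking.{u} :=
  block (n + 1) 2 (binaryGram (n + 1) a c) (binaryGram_isSymm _ a c) (isUnit_det_binaryGram _ a c)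

theorem isEvenAt_binaryBlock (n : ℕ) (a c : ℤ) : (binaryBlock.{u} n a c).IsEvenAt n := by
  intro x
  obtain ⟨s, hs⟩ := ZMod.intCast_surjective (x.down 0)
  obtain ⟨t, ht⟩ := ZMod.intCast_surjective (x.down 1)
  have hform : x.down ⬝ᵥ (binaryGram (n + 1) a c).mulVec x.down =
      ((2 * (a * s ^ 2 + s * t + c * t ^ 2) : ℤ) : ZMod (2 ^ (n + 1))) := by
    simp only [binaryGram, dotProduct, Matrix.mulVec, Fin.sum_univ_two, ← hs, ← ht,
      Matrix.of_apply, Matrix.cons_val_zero, Matrix.cons_val_one]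
    push_cast
    ring
  refine (congrArg (2 ^ n • ·) (block_form x x)).trans ?_
  simp only [hform, zmodFrac_intCast, two_pow_nsmul_frac_succ_eq_zero_iff, even_two_mul]

theorem gaussSum_binaryBlock_ne_zero (n : ℕ) (a c : ℤ) (k : ℕ+) :
    (binaryBlock.{u} n a c).gaussSum k ≠ 0 := by
  obtain ⟨l, rfl⟩ := exists_eq_succPNat k
  by_cases hl : l = n
  · subst hl
    exact gaussSum_ne_zero_iff _ |>.mpr fun z _ => isEvenAt_binaryBlock l a c z
  · exact gaussSum_block_ne_zero fun h => hl (Nat.succ_injective h)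

theorem one_lt_card_binaryBlock (n : ℕ) (a c : ℤ) : 1 < Nat.card (binaryBlock.{u} n a c).G :=
  one_lt_card_block n.succ_pos two_pos

section BinaryBlock

variable {L : TwoLinking.{u}} {n : ℕ}

theorem embeds_binaryBlock (hL : ∀ x : L.G, 2 ^ (n + 1) • x = 0) {a c : ℤ} {x y : L.G}
    (hxx : L.form x x = frac (2 ^ n) a) (hxy : L.form x y = frac (2 ^ (n + 1)) 1)
    (hyy : L.form y y = frac (2 ^ n) c) : Embeds (binaryBlock n a c) L := by
  rw [← frac_two_pow_succ_two_mul, ← zmodFrac_intCast] at hxx hyy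
  rw [← zmodFrac_intCast, Int.cast_one] at hxy
  obtain ⟨f, hf, -⟩ := exists_hom_block (x := ![x, y]) (hs := binaryGram_isSymm (n + 1) a c)
    (hA := isUnit_det_binaryGram (n + 1) a c) (fun i => hL _) fun i j => by
      fin_cases i <;> fin_cases j
      exacts [hxx, hxy, (L.symm y x).trans hxy, hyy]
  exact ⟨f, hf⟩

theorem IsEvenAt.embeds_hyperbolic (heven : L.IsEvenAt n) (hL : ∀ x : L.G, 2 ^ (n + 1) • x = 0)
    (hiso : L.HasIsotropicAt n) : Embeds (binaryBlock n 0 0) L := by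
  obtain ⟨x, y, hxx, hxy, hyy⟩ := heven.exists_hyperbolic_pair hL hiso
  exact embeds_binaryBlock hL (hxx.trans (map_zero _).symm) hxy (hyy.trans (map_zero _).symm)

theorem IsEvenAt.embeds_anisotropic (heven : L.IsEvenAt n) (hL : ∀ x : L.G, 2 ^ (n + 1) • x = 0)
    (hani : ¬ L.HasIsotropicAt n) (htop : ∃ x : L.G, 2 ^ n • x ≠ 0) :
    Embeds (binaryBlock n 1 1) L := by
  obtain ⟨x, y, hxx, hxy, hyy⟩ := heven.exists_anisotropic_pair hL hani htop
  exact embeds_binaryBlock hL hxx hxy hyy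

end BinaryBlock

/-- The cyclic linking pairing with `λ(g, g) = m / 2 ^ N` on a generator `g`, for odd `m`. -/
noncomputable def cyclicBlock (N : ℕ) (m : ℤ) (hm : Odd m) : TwoLinking.{u} :=
  block N 1 (Matrix.of fun _ _ => (m : ZMod (2 ^ N))) (Matrix.IsSymm.ext fun _ _ => rfl)
    (by rw [Matrix.det_fin_one]; exact isUnit_intCast_zmod_two_pow hm N)

/-- The standard generator of a cyclic linking pairing. -/
noncomputable def cyclicGen (N : ℕ) (m : ℤ) (hm : Odd m) : (cyclicBlock.{u} N m hm).G :=
  ULift.up 1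

theorem exists_eq_nsmul_cyclicGen {N : ℕ} {m : ℤ} {hm : Odd m} (y : (cyclicBlock.{u} N m hm).G) :
    ∃ v : ℕ, y = v • cyclicGen N m hm := by
  refine ⟨(y.down 0).val, ULift.down_injective (funext fun i => ?_)⟩
  rw [Subsingleton.elim i 0]
  exact ((nsmul_one _).trans (ZMod.natCast_zmod_val _)).symm

theorem exists_hom_cyclicBlock {L : TwoLinking.{u}} {n : ℕ} {x : L.G}
    (hx : 2 ^ (n + 1) • x = 0) {m : ℤ} (hm : Odd m) (hxx : L.form x x = frac (2 ^ (n + 1)) m) :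
    ∃ f : (cyclicBlock.{u} (n + 1) m hm).G →+ L.G,
      comapForm f L.form = (cyclicBlock.{u} (n + 1) m hm).form ∧
        f (cyclicGen (n + 1) m hm) = x := by
  obtain ⟨f, hf, hfx⟩ := exists_hom_block (x := fun _ => x) (fun _ => hx) fun _ _ =>
    hxx.trans (zmodFrac_intCast _).symm
  have : Fact (1 < 2 ^ (n + 1)) := ⟨Nat.one_lt_two_pow n.succ_ne_zero⟩
  refine ⟨f, hf, (hfx _).trans ?_⟩
  rw [Fin.sum_univ_one]
  exact (congrArg (· • x) (ZMod.val_one _)).trans (one_nsmul x)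

theorem isCharacteristic_of_generator {L : TwoLinking.{u}} {n : ℕ} {x : L.G}
    (hx : 2 ^ (n + 1) • x = 0) (hgen : ∀ y : L.G, ∃ v : ℕ, y = v • x) :
    L.IsCharacteristic n x := by
  intro y
  obtain ⟨v, rfl⟩ := hgen y
  obtain ⟨w, hw⟩ := Int.even_mul_pred_self v
  have hxx : (2 : ℤ) • (2 ^ n • L.form x x) = 0 := by
    rw [two_zsmul, ← two_nsmul, ← mul_nsmul', ← pow_succ', nsmul_form, hx, map_zero,
      AddMonoidHom.zero_apply]
  rw [← sub_eq_zero]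
  simp only [map_nsmul, AddMonoidHom.nsmul_apply, smul_comm (2 ^ n) v]
  simp only [← natCast_zsmul _ v]
  rw [smul_smul, ← sub_smul, show (v : ℤ) - v * v = -w * 2 by linear_combination -hw, mul_smul,
    hxx, smul_zero]

theorem IsCharacteristic.map {B L : TwoLinking.{u}} {f : B.G →+ L.G}
    {hf : comapForm f L.form = B.form} {n : ℕ} (heven : (complement f hf).IsEvenAt n) {x : B.G}
    (hx : B.IsCharacteristic n x) : L.IsCharacteristic n (f x) := by
  intro y
  obtain ⟨⟨v, w⟩, rfl⟩ :=
    (coprod_orthogonal_bijective L.symm (hf ▸ B.adjoint_bijective)).2 y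
  have hw : L.form (f v) w = 0 := mem_orthogonal.mp w.2 v
  have hww : 2 ^ n • L.form w w = 0 := heven w
  have hxv := hx v
  rw [← hf, comapForm_apply, comapForm_apply] at hxv
  change 2 ^ n • L.form (f x) (f v + w) = 2 ^ n • L.form (f v + w) (f v + w)
  rw [form_add_self L.symm, hw, map_add, mem_orthogonal.mp w.2, add_zero, nsmul_zero, add_zero,
    nsmul_add, hxv, hww, add_zero]

theorem exists_odd_cyclic_complement {L : TwoLinking.{u}} {n : ℕ}
    (hL : ∀ x : L.G, 2 ^ (n + 1) • x = 0) {x : L.G} {m : ℤ} (hm : Odd m)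
    (hxx : L.form x x = frac (2 ^ (n + 1)) m) :
    ∃ L', Iso ((cyclicBlock (n + 1) m hm).sum L') L ∧
      (¬ L.IsCharacteristic n x → ¬ L'.IsEvenAt n) := by
  obtain ⟨f, hf, rfl⟩ := exists_hom_cyclicBlock (hL x) hm hxx
  refine ⟨complement f hf, sum_complement_iso f hf, mt fun heven => ?_⟩
  exact (isCharacteristic_of_generator (two_pow_nsmul_block _)
    exists_eq_nsmul_cyclicGen).map heven

theorem one_lt_card_cyclicBlock (n : ℕ) {m : ℤ} (hm : Odd m) :
    1 < Nat.card (cyclicBlock.{u} (n + 1) m hm).G :=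
  one_lt_card_block n.succ_pos one_pos

theorem one_lt_multipleCard_cyclicBlock (n : ℕ) {m : ℤ} (hm : Odd m) :
    1 < multipleCard (cyclicBlock.{u} (n + 1) m hm).G (2 ^ n) := by
  refine lt_of_le_of_ne (multipleCard_pos _) fun h => ?_
  have hgen := multipleCard_eq_one_iff.mp h.symm (cyclicGen (n + 1) m hm)
  have hone : ((2 ^ n : ℕ) : ZMod (2 ^ (n + 1))) = 0 :=
    (nsmul_one _).symm.trans (congrFun (congrArg ULift.down hgen) 0)
  rw [ZMod.natCast_eq_zero_iff, Nat.pow_dvd_pow_iff_le_right one_lt_two] at hone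
  exact n.lt_succ_self.not_ge hone

/-! ### Classification by torsion and Gauss sums -/

/-- Equality of all torsion counts and Gauss sums. -/
structure SameInvariants (L M : TwoLinking.{u}) : Prop where
  torsion : ∀ n, torsionCard L.G n = torsionCard M.G n
  gauss : ∀ k, L.gaussSum k = M.gaussSum k

section SameInvariants

variable {L M : TwoLinking.{u}} {n : ℕ}

theorem SameInvariants.symm (h : SameInvariants L M) : SameInvariants M L :=
  ⟨fun n => (h.torsion n).symm, fun k => (h.gauss k).symm⟩

theorem SameInvariants.card_eq (h : SameInvariants L M) : Nat.card L.G = Nat.card M.G :=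
  have ⟨τ, _⟩ := exists_equiv_of_gaussSum_eq h.gauss
  Nat.card_congr τ

theorem SameInvariants.multipleCard_eq (h : SameInvariants L M) (n : ℕ) :
    multipleCard L.G n = multipleCard M.G n :=
  multipleCard_eq_of_torsionCard_eq (h.torsion n) h.card_eq

theorem SameInvariants.nsmul_eq_zero (h : SameInvariants L M) (hL : ∀ x : L.G, n • x = 0) :
    ∀ x : M.G, n • x = 0 :=
  multipleCard_eq_one_iff.mp ((h.multipleCard_eq n).symm.trans (multipleCard_eq_one_iff.mpr hL))

theorem SameInvariants.exists_nsmul_ne_zero (h : SameInvariants L M)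
    (hL : ∃ x : L.G, n • x ≠ 0) : ∃ x : M.G, n • x ≠ 0 := by
  contrapose! hL
  exact h.symm.nsmul_eq_zero hL

theorem SameInvariants.isEvenAt (h : SameInvariants L M) (heven : L.IsEvenAt n) :
    M.IsEvenAt n := by
  obtain ⟨τ, hτ⟩ := exists_equiv_of_gaussSum_eq h.gauss
  intro x
  obtain ⟨y, rfl⟩ := τ.surjective x
  rw [hτ, heven]

theorem SameInvariants.nullCard_eq (h : SameInvariants L M) (m : ℕ) :
    L.nullCard m = M.nullCard m := by
  obtain ⟨τ, hτ⟩ := exists_equiv_of_gaussSum_eq h.gauss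
  exact Nat.card_congr (τ.subtypeEquiv fun z => by rw [hτ])

theorem SameInvariants.hasIsotropicAt (h : SameInvariants L M) (heven : L.IsEvenAt n)
    (hL : ∀ x : L.G, 2 ^ (n + 1) • x = 0) (hiso : L.HasIsotropicAt n) : M.HasIsotropicAt n := by
  have hMtop : ∃ x : M.G, 2 ^ n • x ≠ 0 :=
    h.exists_nsmul_ne_zero (hiso.imp fun _ hx => hx.1)
  rcases n with _ | m
  · obtain ⟨y, hy⟩ := hMtop
    exact ⟨y, hy, by simpa using h.isEvenAt heven y⟩
  · by_contra hani
    have hlt := card_lt_four_mul_nullCard hL heven hiso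
    have hle := four_mul_nullCard_le_card (h.nsmul_eq_zero hL) (h.isEvenAt heven) hani hMtop
    rw [h.nullCard_eq, h.card_eq] at hlt
    exact hlt.not_ge hle

end SameInvariants

section Splitting

variable {B L L' M M' : TwoLinking.{u}} {n : ℕ}

theorem card_eq_of_iso_sum (hL : Iso (B.sum L') L) :
    Nat.card L.G = Nat.card B.G * Nat.card L'.G := by
  obtain ⟨e, -⟩ := hL
  exact (Nat.card_congr e.toEquiv).symm.trans (Nat.card_prod _ _)

theorem card_lt_of_iso_sum (hL : Iso (B.sum L') L) (hB : 1 < Nat.card B.G) :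
    Nat.card L'.G < Nat.card L.G := by
  rw [card_eq_of_iso_sum hL]
  exact lt_mul_of_one_lt_left Nat.card_pos hB

theorem torsionCard_eq_of_iso_sum (hL : Iso (B.sum L') L) (n : ℕ) :
    torsionCard L.G n = torsionCard B.G n * torsionCard L'.G n := by
  obtain ⟨e, -⟩ := hL
  exact (torsionCard_congr e n).symm.trans (torsionCard_prod _ _ n)

theorem multipleCard_eq_of_iso_sum (hL : Iso (B.sum L') L) (n : ℕ) :
    multipleCard L.G n = multipleCard B.G n * multipleCard L'.G n := by
  rw [← multipleCard_prod]
  exact multipleCard_eq_of_torsionCard_eq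
    ((torsionCard_eq_of_iso_sum hL n).trans (torsionCard_prod _ _ n).symm)
    ((card_eq_of_iso_sum hL).trans (Nat.card_prod _ _).symm)

theorem nsmul_eq_zero_of_iso_sum (hL : Iso (B.sum L') L) (h : ∀ x : L.G, n • x = 0) (y : L'.G) :
    n • y = 0 :=
  have hone := multipleCard_eq_one_iff.mpr h
  multipleCard_eq_one_iff.mp
    (Nat.eq_one_of_mul_eq_one_left ((multipleCard_eq_of_iso_sum hL n).symm.trans hone)) y

theorem card_eq_of_iso_sum_of_card_eq (h : Nat.card L.G = Nat.card M.G) (hL : Iso (B.sum L') L)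
    (hM : Iso (B.sum M') M) : Nat.card L'.G = Nat.card M'.G := by
  rw [card_eq_of_iso_sum hL, card_eq_of_iso_sum hM] at h
  exact Nat.eq_of_mul_eq_mul_left Nat.card_pos h

theorem SameInvariants.cancel_torsion (h : SameInvariants L M) (hL : Iso (B.sum L') L)
    (hM : Iso (B.sum M') M) (n : ℕ) : torsionCard L'.G n = torsionCard M'.G n := by
  have hLM := h.torsion n
  rw [torsionCard_eq_of_iso_sum hL, torsionCard_eq_of_iso_sum hM] at hLM
  exact Nat.eq_of_mul_eq_mul_left (torsionCard_pos _ _) hLM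

theorem SameInvariants.cancel_gauss (h : SameInvariants L M) (hL : Iso (B.sum L') L)
    (hM : Iso (B.sum M') M) {k : ℕ+} (hB : B.gaussSum k ≠ 0) :
    L'.gaussSum k = M'.gaussSum k := by
  have hLM := h.gauss k
  rw [← gaussSum_congr hL, ← gaussSum_congr hM, gaussSum_sum, gaussSum_sum] at hLM
  exact mul_left_cancel₀ hB hLM

/-- Torsion counts and Gauss sums classify the linking pairings on groups of order less than `c`;
this is the hypothesis of the induction on the order. -/
def ClassifiedBelow (c : ℕ) : Prop :=
  ∀ ⦃L M : TwoLinking.{u}⦄, Nat.card L.G < c → SameInvariants L M → Iso L M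

theorem ClassifiedBelow.iso_of_summand (hclass : ClassifiedBelow.{u} (Nat.card L.G))
    (hB : 1 < Nat.card B.G) (hL : Iso (B.sum L') L) (hM : Iso (B.sum M') M)
    (h : SameInvariants L' M') : Iso L M :=
  hL.symm.trans ((sum_congr (Iso.refl B) (hclass (card_lt_of_iso_sum hL hB) h)).trans hM)

theorem ClassifiedBelow.iso_of_embeds (hclass : ClassifiedBelow.{u} (Nat.card L.G))
    (h : SameInvariants L M) (hB : 1 < Nat.card B.G) (hΓ : ∀ k, B.gaussSum k ≠ 0)
    (hL : Embeds B L) (hM : Embeds B M) : Iso L M := by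
  obtain ⟨L', hL'⟩ := hL.exists_iso_sum
  obtain ⟨M', hM'⟩ := hM.exists_iso_sum
  exact hclass.iso_of_summand hB hL' hM'
    ⟨h.cancel_torsion hL' hM', fun k => h.cancel_gauss hL' hM' (hΓ k)⟩

theorem ClassifiedBelow.iso_of_isEvenAt (hclass : ClassifiedBelow.{u} (Nat.card L.G))
    (h : SameInvariants L M) (hL : ∀ x : L.G, 2 ^ (n + 1) • x = 0)
    (htop : ∃ x : L.G, 2 ^ n • x ≠ 0) (heven : L.IsEvenAt n) : Iso L M := by
  have hM := h.nsmul_eq_zero hL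
  have hMeven := h.isEvenAt heven
  by_cases hiso : L.HasIsotropicAt n
  · exact hclass.iso_of_embeds h (one_lt_card_binaryBlock n 0 0)
      (gaussSum_binaryBlock_ne_zero n 0 0) (heven.embeds_hyperbolic hL hiso)
      (hMeven.embeds_hyperbolic hM (h.hasIsotropicAt heven hL hiso))
  · have hMani : ¬ M.HasIsotropicAt n := mt (h.symm.hasIsotropicAt hMeven hM) hiso
    exact hclass.iso_of_embeds h (one_lt_card_binaryBlock n 1 1)
      (gaussSum_binaryBlock_ne_zero n 1 1) (heven.embeds_anisotropic hL hiso htop)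
      (hMeven.embeds_anisotropic hM hMani (h.exists_nsmul_ne_zero htop))

theorem gaussSum_eq_of_isEvenAt_iff (hL : ∀ x : L.G, 2 ^ (n + 1) • x = 0)
    (hM : ∀ x : M.G, 2 ^ (n + 1) • x = 0) (hcard : Nat.card L.G = Nat.card M.G)
    (hparity : L.IsEvenAt n ↔ M.IsEvenAt n) :
    L.gaussSum n.succPNat = M.gaussSum n.succPNat := by
  by_cases heven : L.IsEvenAt n
  · rw [gaussSum_eq_card heven, gaussSum_eq_card (hparity.mp heven), ← Nat.card_eq_fintype_card,
      ← Nat.card_eq_fintype_card, hcard]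
  · rw [(gaussSum_eq_zero_iff hL).mpr heven, (gaussSum_eq_zero_iff hM).mpr (mt hparity.mpr heven)]

theorem SameInvariants.isEvenAt_iff_of_multipleCard_lt_eight (h : SameInvariants L M)
    (hL : ∀ x : L.G, 2 ^ (n + 1) • x = 0) (hL' : Iso (B.sum L') L) (hM' : Iso (B.sum M') M)
    (hB : 1 < multipleCard B.G (2 ^ n)) (hlt : multipleCard L.G (2 ^ n) < 8) :
    L'.IsEvenAt n ↔ M'.IsEvenAt n := by
  have hmul : multipleCard L'.G (2 ^ n) = multipleCard M'.G (2 ^ n) :=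
    multipleCard_eq_of_torsionCard_eq (h.cancel_torsion hL' hM' _)
      (card_eq_of_iso_sum_of_card_eq h.card_eq hL' hM')
  have hlt4 : multipleCard L'.G (2 ^ n) < 4 := by
    rw [multipleCard_eq_of_iso_sum hL'] at hlt
    have := Nat.mul_le_mul_right (multipleCard L'.G (2 ^ n)) hB
    lia
  rw [isEvenAt_iff_multipleCard_eq_one (nsmul_eq_zero_of_iso_sum hL' hL) hlt4,
    isEvenAt_iff_multipleCard_eq_one (nsmul_eq_zero_of_iso_sum hM' (h.nsmul_eq_zero hL))
      (hmul ▸ hlt4), hmul]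

theorem SameInvariants.exists_odd_vectors (h : SameInvariants L M)
    (hL : ∀ x : L.G, 2 ^ (n + 1) • x = 0) (hodd : ¬ L.IsEvenAt n) :
    ∃ x y, 2 ^ n • L.form x x ≠ 0 ∧ M.form y y = L.form x x ∧
      (8 ≤ multipleCard L.G (2 ^ n) → ¬ L.IsCharacteristic n x ∧ ¬ M.IsCharacteristic n y) := by
  obtain ⟨τ, hτ⟩ := exists_equiv_of_gaussSum_eq h.gauss
  by_cases h8 : 8 ≤ multipleCard L.G (2 ^ n)
  · obtain ⟨x, hx, hchar⟩ :=
      exists_not_isCharacteristic hL hodd τ h8 (h.multipleCard_eq _ ▸ h8)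
    exact ⟨x, τ x, hx, hτ x, fun _ => hchar⟩
  · obtain ⟨x, hx⟩ := not_forall.mp hodd
    exact ⟨x, τ x, hx, hτ x, fun h => absurd h h8⟩

/-- Only the Gauss sum of the cyclic summand at its own level vanishes. There the Gauss sums of the
complements are determined by their parity: both are odd if the split vectors are not
characteristic, and otherwise the complements are so small that parity depends on the group only. -/
theorem ClassifiedBelow.iso_of_not_isEvenAt (hclass : ClassifiedBelow.{u} (Nat.card L.G))
    (h : SameInvariants L M) (hL : ∀ x : L.G, 2 ^ (n + 1) • x = 0) (hodd : ¬ L.IsEvenAt n) :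
    Iso L M := by
  have hM := h.nsmul_eq_zero hL
  obtain ⟨x, y, hx, hyx, hchar⟩ := h.exists_odd_vectors hL hodd
  obtain ⟨m, hm, hxm⟩ := exists_odd_form_eq hL hx
  obtain ⟨L', hL', hL'odd⟩ := exists_odd_cyclic_complement hL hm hxm
  obtain ⟨M', hM', hM'odd⟩ := exists_odd_cyclic_complement hM hm (hyx.trans hxm)
  have hparity : L'.IsEvenAt n ↔ M'.IsEvenAt n := by
    rcases lt_or_ge (multipleCard L.G (2 ^ n)) 8 with hlt | hge
    · exact h.isEvenAt_iff_of_multipleCard_lt_eight hL hL' hM'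
        (one_lt_multipleCard_cyclicBlock n hm) hlt
    · exact iff_of_false (hL'odd (hchar hge).1) (hM'odd (hchar hge).2)
  refine hclass.iso_of_summand (one_lt_card_cyclicBlock n hm) hL' hM'
    ⟨h.cancel_torsion hL' hM', fun k => ?_⟩
  obtain ⟨l, rfl⟩ := exists_eq_succPNat k
  by_cases hl : l = n
  · subst hl
    exact gaussSum_eq_of_isEvenAt_iff (nsmul_eq_zero_of_iso_sum hL' hL)
      (nsmul_eq_zero_of_iso_sum hM' hM) (card_eq_of_iso_sum_of_card_eq h.card_eq hL' hM') hparity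
  · exact h.cancel_gauss hL' hM' (gaussSum_block_ne_zero fun h => hl (Nat.succ_injective h))

end Splitting

theorem iso_of_subsingleton {L M : TwoLinking.{u}} [Subsingleton L.G] [Subsingleton M.G] :
    Iso L M := by
  have := uniqueOfSubsingleton (0 : L.G)
  have := uniqueOfSubsingleton (0 : M.G)
  refine ⟨AddEquiv.ofUnique, fun x y => ?_⟩
  rw [Subsingleton.elim x 0, map_zero, map_zero, map_zero, AddMonoidHom.zero_apply,
    AddMonoidHom.zero_apply]

theorem SameInvariants.iso {L M : TwoLinking.{u}} (h : SameInvariants L M) : Iso L M := by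
  induction hc : Nat.card L.G using Nat.strong_induction_on generalizing L M with
  | _ c ih =>
  have hclass : ClassifiedBelow.{u} (Nat.card L.G) := fun L' M' hlt h' => ih _ (hc ▸ hlt) h' rfl
  rcases subsingleton_or_nontrivial L.G with hsub | hnontriv
  · have : Subsingleton M.G := Finite.card_le_one_iff_subsingleton.mp
      (h.card_eq ▸ Finite.card_le_one_iff_subsingleton.mpr hsub)
    exact iso_of_subsingleton
  · obtain ⟨n, hL, htop⟩ := L.exists_exponent
    by_cases heven : L.IsEvenAt n
    · exact hclass.iso_of_isEvenAt h hL htop heven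
    · exact hclass.iso_of_not_isEvenAt h hL heven

/-! ### Orthogonal decompositions and ranks -/

section DirectSum

variable {ι G G' : Type*} [AddCommGroup G] [AddCommGroup G']

theorem iSupIndep_prod {H : ι → AddSubgroup G} {K : ι → AddSubgroup G'} (hH : iSupIndep H)
    (hK : iSupIndep K) : iSupIndep fun i => (H i).prod (K i) := by
  intro i
  have hle : ⨆ (j) (_ : j ≠ i), (H j).prod (K j) ≤
      (⨆ (j) (_ : j ≠ i), H j).prod (⨆ (j) (_ : j ≠ i), K j) :=
    iSup₂_le fun j hj => AddSubgroup.prod_mono (le_iSup₂ (f := fun j (_ : j ≠ i) => H j) j hj)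
      (le_iSup₂ (f := fun j (_ : j ≠ i) => K j) j hj)
  refine Disjoint.mono_right hle (AddSubgroup.disjoint_def.mpr fun {x} hx hx' => ?_)
  exact Prod.ext (AddSubgroup.disjoint_def.mp (hH i) hx.1 hx'.1)
    (AddSubgroup.disjoint_def.mp (hK i) hx.2 hx'.2)

theorem iSup_prod_eq_top {H : ι → AddSubgroup G} {K : ι → AddSubgroup G'} (hH : iSup H = ⊤)
    (hK : iSup K = ⊤) : ⨆ i, (H i).prod (K i) = ⊤ := by
  have hl : (⊤ : AddSubgroup G) ≤ (⨆ i, (H i).prod (K i)).comap (AddMonoidHom.inl G G') :=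
    hH ▸ iSup_le fun i x hx => AddSubgroup.mem_iSup_of_mem i ⟨hx, zero_mem _⟩
  have hr : (⊤ : AddSubgroup G') ≤ (⨆ i, (H i).prod (K i)).comap (AddMonoidHom.inr G G') :=
    hK ▸ iSup_le fun i x hx => AddSubgroup.mem_iSup_of_mem i ⟨zero_mem _, hx⟩
  refine eq_top_iff.mpr fun ⟨x, y⟩ _ => ?_
  have hx : (x, 0) ∈ ⨆ i, (H i).prod (K i) := hl (AddSubgroup.mem_top x)
  have hy : (0, y) ∈ ⨆ i, (H i).prod (K i) := hr (AddSubgroup.mem_top y)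
  simpa only [Prod.mk_add_mk, add_zero, zero_add] using add_mem hx hy

variable [DecidableEq ι]

theorem isInternal_addSubgroup_iff (H : ι → AddSubgroup G) :
    DirectSum.IsInternal H ↔ iSupIndep H ∧ iSup H = ⊤ := by
  have h := DirectSum.isInternal_submodule_iff_iSupIndep_and_iSup_eq_top
    (AddSubgroup.toIntSubmodule ∘ H)
  rw [iSupIndep_map_orderIso_iff, Function.comp_def, ← OrderIso.map_iSup, map_eq_top_iff] at h
  exact h

theorem isInternal_mapAddSubgroup {H : ι → AddSubgroup G} (hH : DirectSum.IsInternal H)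
    (e : G ≃+ G') : DirectSum.IsInternal fun i => e.mapAddSubgroup (H i) := by
  rw [isInternal_addSubgroup_iff] at hH ⊢
  exact ⟨hH.1.map_orderIso e.mapAddSubgroup,
    (e.mapAddSubgroup.map_iSup H).symm.trans (hH.2 ▸ e.mapAddSubgroup.map_top)⟩

theorem isInternal_prod {H : ι → AddSubgroup G} {K : ι → AddSubgroup G'}
    (hH : DirectSum.IsInternal H) (hK : DirectSum.IsInternal K) :
    DirectSum.IsInternal fun i => (H i).prod (K i) := by
  rw [isInternal_addSubgroup_iff] at hH hK ⊢
  exact ⟨iSupIndep_prod hH.1 hK.1, iSup_prod_eq_top hH.2 hK.2⟩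

theorem isInternal_update_bot_top (i : ι) :
    DirectSum.IsInternal (Function.update (fun _ => ⊥) i (⊤ : AddSubgroup G)) := by
  refine (isInternal_addSubgroup_iff _).mpr
    ⟨fun j => ?_, eq_top_iff.mpr (le_iSup_of_le i (by rw [Function.update_self]))⟩
  rcases eq_or_ne j i with rfl | hj
  · refine disjoint_bot_right.mono_right (iSup₂_le fun k hk => ?_)
    rw [Function.update_of_ne hk]
  · rw [Function.update_of_ne hj]
    exact disjoint_bot_left

end DirectSum

section HasRanks

variable {L M : TwoLinking.{u}} {r s : ℕ+ → ℕ}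

theorem HasRanks.congr (h : Iso L M) (hL : L.HasRanks r) : M.HasRanks r := by
  obtain ⟨e, he⟩ := h
  obtain ⟨H, hint, horth, hfree⟩ := hL
  refine ⟨fun k => e.mapAddSubgroup (H k), isInternal_mapAddSubgroup hint e, ?_, fun k => ?_⟩
  · rintro i j hij _ ⟨x, hx, rfl⟩ _ ⟨y, hy, rfl⟩
    exact (he x y).trans (horth i j hij x hx y hy)
  · exact (hfree k).map (e.addSubgroupMap (H k)).symm.trans

theorem HasRanks.sum (hL : L.HasRanks r) (hM : M.HasRanks s) : (L.sum M).HasRanks (r + s) := by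
  obtain ⟨H, hHint, hHorth, hHfree⟩ := hL
  obtain ⟨K, hKint, hKorth, hKfree⟩ := hM
  refine ⟨fun k => (H k).prod (K k), isInternal_prod hHint hKint, ?_, fun k => ?_⟩
  · rintro i j hij ⟨x, y⟩ hxy ⟨x', y'⟩ hxy'
    change L.form x x' + M.form y y' = 0
    rw [hHorth i j hij x hxy.1 x' hxy'.1, hKorth i j hij y hxy.2 y' hxy'.2, add_zero]
  · obtain ⟨f⟩ := hHfree k
    obtain ⟨g⟩ := hKfree k
    have glue : (Fin (r k) ⊕ Fin (s k) → ZMod (2 ^ (k : ℕ))) ≃+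
        (Fin (r k + s k) → ZMod (2 ^ (k : ℕ))) :=
      (LinearEquiv.funCongrLeft ℕ _ finSumFinEquiv).symm.toAddEquiv
    exact ⟨((H k).prodEquiv (K k)).trans ((f.prodCongr g).trans
      ((LinearEquiv.sumArrowLequivProdArrow _ _ ℕ _).symm.toAddEquiv.trans glue))⟩

theorem hasRanks_single (N : ℕ+) {d : ℕ} (e : L.G ≃+ (Fin d → ZMod (2 ^ (N : ℕ)))) :
    L.HasRanks (Pi.single N d) := by
  refine ⟨Function.update (fun _ => ⊥) N ⊤, isInternal_update_bot_top N,
    fun i j hij x hx y hy => ?_, fun k => ?_⟩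
  · rcases eq_or_ne i N with rfl | hi
    · rw [Function.update_of_ne hij.symm, AddSubgroup.mem_bot] at hy
      rw [hy, map_zero]
    · rw [Function.update_of_ne hi, AddSubgroup.mem_bot] at hx
      rw [hx, map_zero, AddMonoidHom.zero_apply]
  · rcases eq_or_ne k N with rfl | hk
    · rw [Function.update_self, Pi.single_eq_same]
      exact ⟨AddSubgroup.topEquiv.trans e⟩
    · rw [Function.update_of_ne hk, Pi.single_eq_of_ne hk]
      exact ⟨AddEquiv.ofUnique⟩

theorem hasRanks_zero [Subsingleton L.G] : L.HasRanks 0 := by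
  have := uniqueOfSubsingleton (0 : L.G)
  exact Pi.single_zero (M := fun _ : ℕ+ => ℕ) 1 ▸ hasRanks_single 1 AddEquiv.ofUnique

end HasRanks

theorem exists_block_summand (L : TwoLinking.{u}) [Nontrivial L.G] :
    ∃ n r A hs hA L', 0 < r ∧ Iso ((block (n + 1) r A hs hA).sum L') L := by
  obtain ⟨n, hL, x, hx⟩ := L.exists_exponent
  by_cases heven : L.IsEvenAt n
  · obtain ⟨y, hxy⟩ := exists_form_eq_frac_one hL hx
    obtain ⟨a, hxx⟩ := heven.exists_form_self_eq x
    obtain ⟨c, hyy⟩ := heven.exists_form_self_eq y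
    obtain ⟨L', hL'⟩ := (embeds_binaryBlock hL hxx hxy hyy).exists_iso_sum
    exact ⟨n, 2, _, _, _, L', two_pos, hL'⟩
  · obtain ⟨z, hz⟩ := not_forall.mp heven
    obtain ⟨m, hm, hzz⟩ := exists_odd_form_eq hL hz
    obtain ⟨f, hf, -⟩ := exists_hom_cyclicBlock (hL z) hm hzz
    exact ⟨n, 1, _, _, _, complement f hf, one_pos, sum_complement_iso f hf⟩

theorem exists_hasRanks (L : TwoLinking.{u}) : ∃ r, L.HasRanks r := by
  induction hc : Nat.card L.G using Nat.strong_induction_on generalizing L with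
  | _ c ih =>
  rcases subsingleton_or_nontrivial L.G with hsub | hnontriv
  · exact ⟨0, hasRanks_zero⟩
  · obtain ⟨n, d, A, hs, hA, L', hd, hL'⟩ := L.exists_block_summand
    have hlt := card_lt_of_iso_sum hL' (one_lt_card_block n.succ_pos hd)
    obtain ⟨r, hr⟩ := ih _ (hc ▸ hlt) L' rfl
    exact ⟨_, ((hasRanks_single n.succPNat AddEquiv.ulift).sum hr).congr hL'⟩

/-! ### Uniqueness of the ranks -/

/-- The direct sum of the groups `(ℤ/2^k)^(r k)`, `k ≥ 1`: the 2-group with ranks `r`. -/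
abbrev StdGroup (r : ℕ+ → ℕ) : Type := DirectSum ℕ+ fun k => Fin (r k) → ZMod (2 ^ (k : ℕ))

theorem HasRanks.nonempty_addEquiv {L : TwoLinking.{u}} {r : ℕ+ → ℕ} (h : L.HasRanks r) :
    Nonempty (L.G ≃+ StdGroup r) := by
  obtain ⟨H, hint, -, hfree⟩ := h
  exact ⟨(AddEquiv.ofBijective _ hint).symm.trans
    (DirectSum.congrAddEquiv fun k => (hfree k).some)⟩

/-- The elements of order at most two in `2 ^ m A`, i.e. the socle of that 2-group. -/
def socle (A : Type*) [AddCommGroup A] (m : ℕ) : Set A :=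
  {x | 2 • x = 0 ∧ ∃ y, 2 ^ m • y = x}

theorem card_socle_congr {A B : Type*} [AddCommGroup A] [AddCommGroup B] (e : A ≃+ B) (m : ℕ) :
    Nat.card (socle A m) = Nat.card (socle B m) := by
  refine Nat.card_congr (e.toEquiv.subtypeEquiv fun x => ?_)
  simp only [socle, Set.mem_ofPred_eq, e.surjective.exists, AddEquiv.toEquiv_eq_coe,
    AddEquiv.coe_toEquiv, ← map_nsmul, e.map_eq_zero_iff, e.injective.eq_iff]

section StdGroup

variable {r : ℕ+ → ℕ} {m : ℕ}

theorem two_pow_nsmul_zmodPi_eq_zero {d N : ℕ} (h : N ≤ m) (v : Fin d → ZMod (2 ^ N)) :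
    2 ^ m • v = 0 := by
  obtain ⟨c, rfl⟩ := Nat.exists_eq_add_of_le h
  rw [pow_add, mul_comm, mul_nsmul', ZModModule.char_nsmul_eq_zero (2 ^ N), nsmul_zero]

theorem exists_two_pow_nsmul_zmodPi_eq {d N : ℕ} (h : m < N) {v : Fin d → ZMod (2 ^ N)}
    (hv : 2 • v = 0) : ∃ w, 2 ^ m • w = v := by
  obtain ⟨c, rfl⟩ := Nat.exists_eq_add_of_lt h
  have hpow : 2 * 2 ^ (m + c) = 2 ^ (m + c + 1) := (pow_succ' 2 (m + c)).symm
  choose w hw using fun i => exists_eq_nsmul_of_nsmul_eq_zero hpow (congrFun hv i)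
  refine ⟨2 ^ c • w, ?_⟩
  rw [← mul_nsmul', ← pow_add]
  exact (funext hw).symm

theorem exists_nsmul_eq_of_forall_component {c : ℕ} {x : StdGroup r}
    (h : ∀ k, ∃ y, c • y = x k) : ∃ y, c • y = x := by
  classical
  choose y hy using h
  have hx : x ∈ (nsmulAddMonoidHom (α := StdGroup r) c).range := by
    rw [← DirectSum.sum_support_of x]
    refine sum_mem fun k _ => ⟨DirectSum.of _ k (y k), ?_⟩
    rw [nsmulAddMonoidHom_apply, ← map_nsmul, hy]
  exact hx

theorem mem_socle_stdGroup_iff {x : StdGroup r} :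
    x ∈ socle (StdGroup r) m ↔ 2 • x = 0 ∧ ∀ k : ℕ+, (k : ℕ) ≤ m → x k = 0 := by
  refine and_congr_right fun hx => ⟨?_, fun h => ?_⟩
  · rintro ⟨y, rfl⟩ k hk
    exact two_pow_nsmul_zmodPi_eq_zero hk (y k)
  · refine exists_nsmul_eq_of_forall_component fun k => ?_
    rcases le_or_gt (k : ℕ) m with hk | hk
    · exact ⟨0, (nsmul_zero _).trans (h k hk).symm⟩
    · exact exists_two_pow_nsmul_zmodPi_eq hk (congrArg (fun z : StdGroup r => z k) hx)

theorem torsionCard_pi_fin (A : Type*) [AddCommGroup A] (d n : ℕ) :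
    torsionCard (Fin d → A) n = torsionCard A n ^ d := by
  have hpow : Nat.card (Fin d → {a : A // n • a = 0}) = torsionCard A n ^ d := by
    rw [Nat.card_fun, Nat.card_fin, torsionCard]
  rw [← hpow]
  exact Nat.card_congr ((Equiv.subtypeEquivRight fun _ => funext_iff).trans
    (Equiv.subtypePiEquivPi (p := fun _ a => n • a = 0)))

theorem one_lt_torsionCard_zmod_two_pow {N : ℕ} (hN : N ≠ 0) :
    1 < torsionCard (ZMod (2 ^ N)) 2 := by
  obtain ⟨m, rfl⟩ := Nat.exists_eq_succ_of_ne_zero hN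
  have : Nontrivial {z : ZMod (2 ^ (m + 1)) // 2 • z = 0} := by
    refine ⟨⟨0, nsmul_zero 2⟩, ⟨((2 ^ m : ℕ) : ZMod (2 ^ (m + 1))), ?_⟩, fun h => ?_⟩
    · rw [nsmul_eq_mul, ← Nat.cast_mul, ← pow_succ', ZMod.natCast_self]
    · have hdvd := (ZMod.natCast_eq_zero_iff _ _).mp (Subtype.ext_iff.mp h).symm
      rw [Nat.pow_dvd_pow_iff_le_right one_lt_two] at hdvd
      exact m.lt_succ_self.not_ge hdvd
  exact Finite.one_lt_card

theorem mem_socle_natPred_iff {k : ℕ+} {x : StdGroup r} :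
    x ∈ socle (StdGroup r) k.natPred ↔ 2 • x = 0 ∧ ∀ j < k, x j = 0 := by
  have hle (j : ℕ+) : (j : ℕ) ≤ k.natPred ↔ j < k := by
    rw [← Nat.lt_succ_iff, Nat.succ_eq_add_one, k.natPred_add_one, PNat.coe_lt_coe]
  simp only [mem_socle_stdGroup_iff, hle]

theorem of_add_mem_socle {k : ℕ+} {v : Fin (r k) → ZMod (2 ^ (k : ℕ))} (hv : 2 • v = 0)
    {x : StdGroup r} (hx : x ∈ socle (StdGroup r) k) :
    DirectSum.of _ k v + x ∈ socle (StdGroup r) k.natPred := by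
  rw [mem_socle_stdGroup_iff] at hx
  refine mem_socle_natPred_iff.mpr ⟨?_, fun j hj => ?_⟩
  · rw [nsmul_add, ← map_nsmul, hv, map_zero, hx.1, add_zero]
  · rw [DirectSum.add_apply, DirectSum.of_eq_of_ne _ _ _ hj.ne, hx.2 j hj.le, add_zero]

theorem sub_of_mem_socle {k : ℕ+} {x : StdGroup r} (hx : x ∈ socle (StdGroup r) k.natPred) :
    x - DirectSum.of _ k (x k) ∈ socle (StdGroup r) k := by
  rw [mem_socle_natPred_iff] at hx
  refine mem_socle_stdGroup_iff.mpr ⟨?_, fun j hj => ?_⟩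
  · have hcomp : 2 • x k = 0 := congrArg (fun z : StdGroup r => z k) hx.1
    rw [nsmul_sub, hx.1, ← map_nsmul, hcomp, map_zero, sub_zero]
  · rcases eq_or_ne j k with rfl | hne
    · rw [DirectSum.sub_apply, DirectSum.of_eq_same, sub_self]
    · rw [DirectSum.sub_apply, DirectSum.of_eq_of_ne _ _ _ hne, hx.2 j (lt_of_le_of_ne hj hne),
        sub_zero]

/-- The component in `(ℤ/2^k)^(r k)` splits off the elements of `socle (StdGroup r) (k - 1)`. -/
def socleSplitting (r : ℕ+ → ℕ) (k : ℕ+) : socle (StdGroup r) k.natPred ≃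
    {v : Fin (r k) → ZMod (2 ^ (k : ℕ)) // 2 • v = 0} × socle (StdGroup r) k where
  toFun x := (⟨x.1 k, congrArg (fun z : StdGroup r => z k) x.2.1⟩, ⟨_, sub_of_mem_socle x.2⟩)
  invFun p := ⟨_, of_add_mem_socle p.1.2 p.2.2⟩
  left_inv x := Subtype.ext (add_sub_cancel _ _)
  right_inv p := by
    have hcomp : (DirectSum.of _ k p.1.1 + p.2.1 : StdGroup r) k = p.1.1 := by
      rw [DirectSum.add_apply, DirectSum.of_eq_same, (mem_socle_stdGroup_iff.mp p.2.2).2 k le_rfl,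
        add_zero]
    refine Prod.ext (Subtype.ext hcomp) (Subtype.ext ?_)
    simp only [hcomp, add_sub_cancel_left]

theorem card_socle_stdGroup (r : ℕ+ → ℕ) (k : ℕ+) :
    Nat.card (socle (StdGroup r) k.natPred) =
      torsionCard (ZMod (2 ^ (k : ℕ))) 2 ^ r k * Nat.card (socle (StdGroup r) k) := by
  rw [← torsionCard_pi_fin, torsionCard, ← Nat.card_prod]
  exact Nat.card_congr (socleSplitting r k)

end StdGroup

theorem HasRanks.card_socle {L : TwoLinking.{u}} {r : ℕ+ → ℕ} (h : L.HasRanks r) (k : ℕ+) :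
    Nat.card (socle L.G k.natPred) =
      torsionCard (ZMod (2 ^ (k : ℕ))) 2 ^ r k * Nat.card (socle L.G k) := by
  obtain ⟨e⟩ := h.nonempty_addEquiv
  rw [card_socle_congr e, card_socle_congr e, card_socle_stdGroup]

theorem HasRanks.unique {L : TwoLinking.{u}} {r s : ℕ+ → ℕ} (hr : L.HasRanks r)
    (hs : L.HasRanks s) : r = s := by
  funext k
  have : Nonempty (socle L.G k) := ⟨⟨0, nsmul_zero _, 0, nsmul_zero _⟩⟩
  exact Nat.pow_right_injective (one_lt_torsionCard_zmod_two_pow k.ne_zero)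
    (Nat.eq_of_mul_eq_mul_right Nat.card_pos ((hr.card_socle k).symm.trans (hs.card_socle k)))

/-! ### The tableau of a linking pairing -/

section HasInvariants

variable {L M : TwoLinking.{u}} {T T' : Tableau}

theorem exists_hasInvariants (L : TwoLinking.{u}) : ∃ T, L.HasInvariants T := by
  obtain ⟨r, hr⟩ := L.exists_hasRanks
  choose s hs using L.exists_hasSignature
  exact ⟨fun k => (r k, s k), hr, hs⟩

theorem HasInvariants.unique (h : L.HasInvariants T) (h' : L.HasInvariants T') : T = T' :=
  funext fun k => Prod.ext (congrFun (h.1.unique h'.1) k) ((h.2 k).unique (h'.2 k))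

theorem HasInvariants.congr (e : Iso L M) (h : L.HasInvariants T) : M.HasInvariants T :=
  ⟨h.1.congr e, fun k => (h.2 k).congr e⟩

theorem HasInvariants.sum (h : L.HasInvariants T) (h' : M.HasInvariants T') :
    (L.sum M).HasInvariants (T + T') :=
  ⟨h.1.sum h'.1, fun k => (h.2 k).sum (h'.2 k)⟩

theorem hasInvariants_trivial : (trivial.{u}).HasInvariants 0 :=
  have : Subsingleton (trivial.{u}).G := inferInstanceAs (Subsingleton PUnit)
  ⟨hasRanks_zero, hasSignature_trivial⟩

theorem HasInvariants.iso (hL : L.HasInvariants T) (hM : M.HasInvariants T) : Iso L M := by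
  obtain ⟨e⟩ := hL.1.nonempty_addEquiv
  obtain ⟨f⟩ := hM.1.nonempty_addEquiv
  have htors := torsionCard_congr (e.trans f.symm)
  have hcard := Fintype.card_congr (e.trans f.symm).toEquiv
  exact SameInvariants.iso ⟨htors, fun k =>
    gaussSum_eq_of_hasSignature (hL.2 k) (hM.2 k) hcard (htors _)⟩

/-- The tableau `(ρ_k(L), σ_k(L))_{k ≥ 1}`. -/
noncomputable def tableau (L : TwoLinking.{u}) : Tableau := L.exists_hasInvariants.choose

theorem tableau_eq_iff : L.tableau = T ↔ L.HasInvariants T :=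
  have h : L.HasInvariants L.tableau := L.exists_hasInvariants.choose_spec
  ⟨fun hT => hT ▸ h, h.unique⟩

theorem hasInvariants_tableau (L : TwoLinking.{u}) : L.HasInvariants L.tableau :=
  tableau_eq_iff.mp rfl

theorem tableau_eq_tableau_iff : L.tableau = M.tableau ↔ Iso L M :=
  ⟨fun h => L.hasInvariants_tableau.iso (h ▸ M.hasInvariants_tableau),
    fun e => tableau_eq_iff.mpr (M.hasInvariants_tableau.congr e.symm)⟩

theorem tableau_sum (L M : TwoLinking.{u}) : (L.sum M).tableau = L.tableau + M.tableau :=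
  tableau_eq_iff.mpr (L.hasInvariants_tableau.sum M.hasInvariants_tableau)

end HasInvariants

end TwoLinking

/-- The submonoid of admissible tableaux. -/
def Tableau.admissible : AddSubmonoid Tableau where
  carrier := {T | Tableau.IsAdmissible.{u} T}
  zero_mem' := ⟨_, TwoLinking.hasInvariants_trivial⟩
  add_mem' := fun ⟨L, hL⟩ ⟨M, hM⟩ => ⟨L.sum M, hL.sum hM⟩

namespace LinkingMonoid

/-- The map `[L] ↦ (ρ_k(L), σ_k(L))_{k ≥ 1}` into the admissible tableaux. -/
noncomputable def invariants : LinkingMonoid.{u} →ₙ+ Tableau.admissible.{u} where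
  toFun := Quotient.lift (fun L => ⟨L.tableau, L, L.hasInvariants_tableau⟩) fun _ _ h =>
    Subtype.ext (TwoLinking.tableau_eq_tableau_iff.mpr h)
  map_add' a b := Quotient.inductionOn₂ a b fun L M => Subtype.ext (L.tableau_sum M)

theorem invariants_injective : Function.Injective invariants.{u} := fun a b =>
  Quotient.inductionOn₂ a b fun _ _ h =>
    Quotient.sound (TwoLinking.tableau_eq_tableau_iff.mp (congrArg Subtype.val h))

theorem invariants_surjective : Function.Surjective invariants.{u} := fun ⟨_, L, hL⟩ =>
  ⟨mk L, Subtype.ext (TwoLinking.tableau_eq_iff.mpr hL)⟩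

end LinkingMonoid

theorem mainTheorem2 :
    ∃ Tadm : AddSubmonoid Tableau,
      (∀ T : Tableau, T ∈ Tadm ↔ Tableau.IsAdmissible.{u} T) ∧
      ∃ φ : LinkingMonoid.{u} ≃+ Tadm,
        ∀ (L : TwoLinking.{u}) (T : Tableau),
          (φ (LinkingMonoid.mk L) : Tableau) = T ↔ L.HasInvariants T := by
  exact ⟨Tableau.admissible, fun _ => Iff.rfl,
    AddEquiv.ofBijective LinkingMonoid.invariants
      ⟨LinkingMonoid.invariants_injective, LinkingMonoid.invariants_surjective⟩,
    fun _ _ => TwoLinking.tableau_eq_iff⟩
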